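/- Let $k\ge 1$ and let $(X,g)$ be a compact Riemannian manifold of dimension $n=4k$ with smooth boundary $M$, inclusion $\imath_M:M\hookrightarrow X$, induced metric $h=\imath_M^*g$ and inner unit normal field $\nu$. For some $\varepsilon>0$ let $[0,\varepsilon)\times M\hookrightarrow X$, $(t,q)\mapsto\exp_q(t\nu)$, be the embedding defined by the geodesic normal flow of $g$ from the boundary, and let $g_0$ be any Riemannian metric on $X$ whose pull-back under this embedding equals $dt^2+h$ near $M$ (that is, on $[0,\delta)\times M$ for some $0<\delta\le\varepsilon$). Let $\nabla^1,\nabla^0$ be the Levi-Civita connections of $g$ and $g_0$, let $\theta=\nabla^1-\nabla^0\in\Lambda^1(X,\mathrm{End}(TX))$, and for $s\in\mathbb{R}$ let $R^s\in\Lambda^2(X,\mathrm{End}(TX))$ be the curvature of the connection $\nabla^0+s\theta$. Endomorphism-valued forms are multiplied by $(\omega\otimes B)(\omega'\otimes B')=\omega\wedge\omega'\otimes BB'$, and $\mathrm{tr}(\omega\otimes B)=\mathrm{tr}(B)\,\omega$. If the Weyl tensor of $g$, that is, $\langle R^1_{U_1U_2}U_3,U_4\rangle$ minus $$\mathfrak{S}(U_1,U_4)\langle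 U_2,U_3\rangle+\mathfrak{S}(U_2,U_3)\langle U_1,U_4\rangle-\mathfrak{S}(U_1,U_3)\langle U_2,U_4\rangle-\mathfrak{S}(U_2,U_4)\langle U_1,U_3\rangle,\qquad \mathfrak{S}=\tfrac{1}{n-2}\Bigl(\mathrm{Ric}-\tfrac{\mathrm{scal}}{2(n-1)}\,g\Bigr),$$ vanishes at a point $p\in M$, then for every real polynomial $Q$ and every $s\in\mathbb{R}$ the pull-back $$\imath_M^*\,\mathrm{tr}\bigl(\theta\,Q(R^s)\bigr)\in\Lambda^*(M)$$ vanishes at $p$. -/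

import Mathlib

open Set Bundle
open scoped Manifold ContDiff Topology TensorProduct

set_option maxSynthPendingDepth 3

noncomputable section

namespace Transgression

/-! ### Levi-Civita connections and curvature in coordinates

Here `G` is a field of symmetric bilinear forms and `S` a set with unique differentials in a vector
space `E` (below: the half-space), so that derivatives are one-sided at boundary points. -/

section Coordinates

variable {E : Type*} [NormedAddCommGroup E] [NormedSpace ℝ E]

/-- Doubled Christoffel symbols of the first kind of `G` at `e`:
`koszul G S e u v w = ∂_u G(v, w) + ∂_v G(u, w) - ∂_w G(u, v)`. -/
def koszul (G : E → E →L[ℝ] E →L[ℝ] ℝ) (S : Set E) (e : E) : E →L[ℝ] E →L[ℝ] E →L[ℝ] ℝ :=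
  let D : E →L[ℝ] E →L[ℝ] E →L[ℝ] ℝ := fderivWithin ℝ G S e
  let F : (E →L[ℝ] E →L[ℝ] ℝ) →L[ℝ] (E →L[ℝ] E →L[ℝ] ℝ) :=
    (ContinuousLinearMap.flipₗᵢ ℝ E E ℝ).toContinuousLinearEquiv
  let T : E →L[ℝ] E →L[ℝ] E →L[ℝ] ℝ := F ∘L D.flip
  D + D.flip - T

theorem koszul_apply (G : E → E →L[ℝ] E →L[ℝ] ℝ) (S : Set E) (e u v w : E) :
    koszul G S e u v w = fderivWithin ℝ G S e u v w + fderivWithin ℝ G S e v u w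
      - fderivWithin ℝ G S e w u v := rfl

/-- Christoffel symbols of the Levi-Civita connection of `G` at `e`. For constant vector fields
`u`, `v` the covariant derivative `∇_u v` at `e` is `christoffelOf G S e u v`, the vector with
`G(∇_u v, w) = (∂_u G(v, w) + ∂_v G(u, w) - ∂_w G(u, v)) / 2` for all `w`; here
`(G e).inverse` raises the index. -/
def christoffelOf (G : E → E →L[ℝ] E →L[ℝ] ℝ) (S : Set E) (e : E) : E →L[ℝ] E →L[ℝ] E :=
  (1 / 2 : ℝ) • (ContinuousLinearMap.compL ℝ E (E →L[ℝ] ℝ) E (G e).inverse ∘L koszul G S e)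

theorem christoffelOf_apply (G : E → E →L[ℝ] E →L[ℝ] ℝ) (S : Set E) (e u v : E) :
    christoffelOf G S e u v = (1 / 2 : ℝ) • (G e).inverse (koszul G S e u v) := rfl

/-- Curvature at `e` of the connection `d + Γ`:
`R(u, v) = ∂_u Γ(v) - ∂_v Γ(u) + Γ(u) Γ(v) - Γ(v) Γ(u)`, where `Γ(u)` is the endomorphism
`w ↦ Γ(u, w)`; that is, `R(U, V) = [∇_U, ∇_V] - ∇_[U, V]`. -/
def curvatureOf (Γ : E → E →L[ℝ] E →L[ℝ] E) (S : Set E) (e : E) :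
    E →L[ℝ] E →L[ℝ] E →L[ℝ] E :=
  let D : E →L[ℝ] E →L[ℝ] E →L[ℝ] E := fderivWithin ℝ Γ S e
  let P : E →L[ℝ] E →L[ℝ] E →L[ℝ] E :=
    (ContinuousLinearMap.compL ℝ E E E).bilinearComp (Γ e) (Γ e)
  D - D.flip + (P - P.flip)

theorem curvatureOf_apply (Γ : E → E →L[ℝ] E →L[ℝ] E) (S : Set E) (e u v w : E) :
    curvatureOf Γ S e u v w = fderivWithin ℝ Γ S e u v w - fderivWithin ℝ Γ S e v u w
      + (Γ e u (Γ e v w) - Γ e v (Γ e u w)) := rfl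

end Coordinates

/-! ### Tensors on a Riemannian manifold with boundary

The tangent space at `x` is `ℝⁿ` through the preferred chart at `x`; all tensors at `x` are
computed in that chart. -/

/-- The model vector space `ℝⁿ`. -/
abbrev Eu (n : ℕ) : Type := EuclideanSpace ℝ (Fin n)

section Tensors

variable {n : ℕ} [NeZero n] {X : Type*} [TopologicalSpace X]
  [ChartedSpace (EuclideanHalfSpace n) X] [IsManifold (𝓡∂ n) ∞ X]

variable (n X) in
/-- Smooth Riemannian metrics on a smooth `n`-manifold with boundary `X`. -/
abbrev SmoothMetric : Type _ :=
  ContMDiffRiemannianMetric (𝓡∂ n) ∞ (Eu n) (TangentSpace (𝓡∂ n) : X → Type _)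

/-- The metric `g` in the preferred chart around `x`, i.e. its pull-back under the inverse of
that chart: at `e` it is the bilinear form with matrix `g_ij(e)`. -/
def metricInChart (g : SmoothMetric n X) (x : X) (e : Eu n) : Eu n →L[ℝ] Eu n →L[ℝ] ℝ :=
  let D : Eu n →L[ℝ] Eu n :=
    mfderivWithin 𝓘(ℝ, Eu n) (𝓡∂ n) (extChartAt (𝓡∂ n) x).symm (range (𝓡∂ n)) e
  let b : Eu n →L[ℝ] Eu n →L[ℝ] ℝ := g.inner ((extChartAt (𝓡∂ n) x).symm e)
  b.bilinearComp D D

/-- Christoffel symbols of the Levi-Civita connection of `g` in the chart around `x`. -/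
def christoffel (g : SmoothMetric n X) (x : X) (e : Eu n) : Eu n →L[ℝ] Eu n →L[ℝ] Eu n :=
  christoffelOf (metricInChart g x) (range (𝓡∂ n)) e

/-- Christoffel symbols, in the chart around `x`, of the connection `∇ˢ = ∇⁰ + s (∇¹ - ∇⁰)`, where
`∇¹`, `∇⁰` are the Levi-Civita connections of `g`, `g₀`. -/
def segmentSymbols (g₀ g : SmoothMetric n X) (s : ℝ) (x : X) (e : Eu n) :
    Eu n →L[ℝ] Eu n →L[ℝ] Eu n :=
  christoffel g₀ x e + s • (christoffel g x e - christoffel g₀ x e)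

/-- The tensor `θ = ∇¹ - ∇⁰` at `x`: the endomorphism `θ(u)` is `v ↦ ∇¹_u v - ∇⁰_u v`. -/
def theta (g₀ g : SmoothMetric n X) (x : X) (u : TangentSpace (𝓡∂ n) x) :
    Module.End ℝ (TangentSpace (𝓡∂ n) x) :=
  let e : Eu n := extChartAt (𝓡∂ n) x x
  let T : Eu n →L[ℝ] Eu n := (christoffel g x e - christoffel g₀ x e) u
  (T.toLinearMap : Eu n →ₗ[ℝ] Eu n)

/-- The curvature `Rˢ(u, v)` at `x` of the connection `∇ˢ = ∇⁰ + s θ`. -/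
def segmentCurvature (g₀ g : SmoothMetric n X) (s : ℝ) (x : X) (u v : TangentSpace (𝓡∂ n) x) :
    Module.End ℝ (TangentSpace (𝓡∂ n) x) :=
  let T : Eu n →L[ℝ] Eu n :=
    curvatureOf (segmentSymbols g₀ g s x) (range (𝓡∂ n)) (extChartAt (𝓡∂ n) x x) u v
  (T.toLinearMap : Eu n →ₗ[ℝ] Eu n)

/-- The curvature of the Levi-Civita connection of `g` at `x`. -/
def riemann (g : SmoothMetric n X) (x : X) : Eu n →L[ℝ] Eu n →L[ℝ] Eu n →L[ℝ] Eu n :=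
  curvatureOf (christoffel g x) (range (𝓡∂ n)) (extChartAt (𝓡∂ n) x x)

/-- Ricci tensor at `x`: `Ric(v, w)` is the trace of `u ↦ R(u, v) w`. -/
def ricci (g : SmoothMetric n X) (x : X) (v w : Eu n) : ℝ :=
  LinearMap.trace ℝ (Eu n) (((riemann g x).flip v).flip w).toLinearMap

/-- Scalar curvature at `x`: the trace `∑ᵢⱼ g^{ij} Ric(eᵢ, eⱼ)`; here `∑ⱼ g^{ij} eⱼ` is the vector dual
to the coordinate `xᵢ`. -/
def scalarCurvature (g : SmoothMetric n X) (x : X) : ℝ :=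
  ∑ i : Fin n, ricci g x (EuclideanSpace.single i 1)
    ((metricInChart g x (extChartAt (𝓡∂ n) x x)).inverse (EuclideanSpace.proj i))

/-- Schouten tensor at `x`: `(1 / (n - 2)) (Ric - scal / (2 (n - 1)) g)`. -/
def schouten (g : SmoothMetric n X) (x : X) (u v : TangentSpace (𝓡∂ n) x) : ℝ :=
  1 / ((n : ℝ) - 2) *
    (ricci g x u v - scalarCurvature g x / (2 * ((n : ℝ) - 1)) * g.inner x u v)

/-- Weyl tensor at `x`: `⟨R(u₁, u₂) u₃, u₄⟩` minus the Kulkarni-Nomizu product of the Schouten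
tensor with `g`. -/
def weyl (g : SmoothMetric n X) (x : X) (u₁ u₂ u₃ u₄ : TangentSpace (𝓡∂ n) x) : ℝ :=
  g.inner x (riemann g x u₁ u₂ u₃ : Eu n) u₄
    - (schouten g x u₁ u₄ * g.inner x u₂ u₃ + schouten g x u₂ u₃ * g.inner x u₁ u₄
      - schouten g x u₁ u₃ * g.inner x u₂ u₄ - schouten g x u₂ u₄ * g.inner x u₁ u₃)

/-- `γ` is a smooth geodesic of `g` on the set of times `T`: in the chart around each of its points,
`γ'' + Γ(γ', γ') = 0`. -/
def IsGeodesicOn (g : SmoothMetric n X) (γ : ℝ → X) (T : Set ℝ) : Prop :=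
  ContMDiffOn 𝓘(ℝ, ℝ) (𝓡∂ n) ∞ γ T ∧
  ∀ t ∈ T,
    let c : ℝ → Eu n := fun τ ↦ extChartAt (𝓡∂ n) (γ t) (γ τ)
    iteratedDerivWithin 2 c T t
      + christoffel g (γ t) (c t) (derivWithin c T t) (derivWithin c T t) = 0

end Tensors

/-! ### Endomorphism-valued forms at a point -/

section Forms

variable (V : Type*) [AddCommGroup V] [Module ℝ V]

/-- `Λ^*(V^*)`, the algebra of exterior forms on `V`. -/
abbrev Forms : Type _ := ExteriorAlgebra ℝ (Module.Dual ℝ V)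

/-- `Λ^*(V^*) ⊗ End V`, with product `(ω ⊗ B) (ω' ⊗ B') = (ω ∧ ω') ⊗ (B B')`. -/
abbrev EndForms : Type _ := Forms V ⊗[ℝ] Module.End ℝ V

variable {V}

/-- The trace `tr (ω ⊗ B) = tr(B) ω`. -/
def trForm : EndForms V →ₗ[ℝ] Forms V :=
  (TensorProduct.rid ℝ (Forms V)).toLinearMap ∘ₗ
    LinearMap.lTensor (Forms V) (LinearMap.trace ℝ V)

theorem trForm_tmul (α : Forms V) (B : Module.End ℝ V) :
    trForm (α ⊗ₜ[ℝ] B) = LinearMap.trace ℝ V B • α := by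
  simp [trForm]

/-- The endomorphism-valued 1-form `∑ᵢ eⁱ ⊗ T(eᵢ)` with values `T(u)`. -/
def oneForm {n : ℕ} (b : Module.Basis (Fin n) ℝ V) (T : V → Module.End ℝ V) : EndForms V :=
  ∑ i, ExteriorAlgebra.ι ℝ (b.coord i) ⊗ₜ[ℝ] T (b i)

/-- The endomorphism-valued 2-form `∑_{i<j} eⁱ ∧ eʲ ⊗ R(eᵢ, eⱼ)` with values `R(u, v)`. -/
def twoForm {n : ℕ} (b : Module.Basis (Fin n) ℝ V) (R : V → V → Module.End ℝ V) : EndForms V :=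
  ∑ i, ∑ j ∈ Finset.Ioi i,
    (ExteriorAlgebra.ι ℝ (b.coord i) * ExteriorAlgebra.ι ℝ (b.coord j)) ⊗ₜ[ℝ] R (b i) (b j)

/-- Pull-back of exterior forms under a linear map. -/
def pullbackForms {U : Type*} [AddCommGroup U] [Module ℝ U] (f : U →ₗ[ℝ] V) :
    Forms V →ₐ[ℝ] Forms U :=
  ExteriorAlgebra.map f.dualMap

end Forms

section Transgression

variable {n : ℕ} [NeZero n] {X : Type*} [TopologicalSpace X]
  [ChartedSpace (EuclideanHalfSpace n) X] [IsManifold (𝓡∂ n) ∞ X]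

/-- The coordinate basis of the tangent space at `x`. -/
def coordBasis (n : ℕ) [NeZero n] {X : Type*} [TopologicalSpace X]
    [ChartedSpace (EuclideanHalfSpace n) X] (x : X) :
    Module.Basis (Fin n) ℝ (TangentSpace (𝓡∂ n) x) :=
  ((EuclideanSpace.basisFun (Fin n) ℝ).toBasis : Module.Basis (Fin n) ℝ (Eu n))

/-- The form `tr(θ Q(Rˢ))` at the point `x` of `X`, an element of `Λ^*(T_x^* X)`. -/
def transgressionForm (g₀ g : SmoothMetric n X) (Q : Polynomial ℝ) (s : ℝ) (x : X) :
    Forms (TangentSpace (𝓡∂ n) x) :=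
  trForm (oneForm (coordBasis n x) (theta g₀ g x)
    * Polynomial.aeval (twoForm (coordBasis n x) (segmentCurvature g₀ g s x)) Q)

end Transgression

/-! ### The boundary, its normal geodesic collar, and metrics of product type -/

section Boundary

variable {m : ℕ} {X : Type*} [TopologicalSpace X] [ChartedSpace (EuclideanHalfSpace (m + 1)) X]
  {M : Type*} [TopologicalSpace M] [ChartedSpace (EuclideanSpace ℝ (Fin m)) M]

/-- `ι` is a smooth embedding that identifies `M` with the boundary of `X`. -/
structure IsBoundaryInclusion (ι : M → X) : Prop where
  embedding : Manifold.IsSmoothEmbedding (𝓡 m) (𝓡∂ (m + 1)) ∞ ι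
  range_eq : range ι = (𝓡∂ (m + 1)).boundary X

variable [IsManifold (𝓡∂ (m + 1)) ∞ X]

/-- The induced metric `h = ι^* g` on `M`. -/
def inducedMetric (g : SmoothMetric (m + 1) X) (ι : M → X) (q : M) (u v : TangentSpace (𝓡 m) q) : ℝ :=
  g.inner (ι q) (mfderiv (𝓡 m) (𝓡∂ (m + 1)) ι q u) (mfderiv (𝓡 m) (𝓡∂ (m + 1)) ι q v)

/-- `ν` is the inner unit normal of the boundary at `ι q`. (The tangent space at `ι q` is
`ℝ^(m+1)` through the preferred chart, which takes values in the half-space `x₀ ≥ 0`, so vectors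
pointing inward are those with positive zeroth coordinate.) -/
structure IsInnerUnitNormal (g : SmoothMetric (m + 1) X) (ι : M → X) (q : M)
    (ν : TangentSpace (𝓡∂ (m + 1)) (ι q)) : Prop where
  unit : g.inner (ι q) ν ν = 1
  normal : ∀ u : TangentSpace (𝓡 m) q, g.inner (ι q) ν (mfderiv (𝓡 m) (𝓡∂ (m + 1)) ι q u) = 0
  inward : 0 < (show Eu (m + 1) from ν) 0

/-- The velocity `∂Φ/∂t (t, q)` of a map `Φ : [0, ε) × M → X` (one-sided at `t = 0`). -/
def collarVelocity (ε : ℝ) (Φ : ℝ → M → X) (t : ℝ) (q : M) :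
    TangentSpace (𝓡∂ (m + 1)) (Φ t q) :=
  mfderivWithin 𝓘(ℝ, ℝ) (𝓡∂ (m + 1)) (fun τ ↦ Φ τ q) (Ico 0 ε) t (1 : ℝ)

/-- The differential of a map `Φ : [0, ε) × M → X` at `(t, q)`, applied to `a ∂_t + u`. -/
def collarDeriv (ε : ℝ) (Φ : ℝ → M → X) (t : ℝ) (q : M) (a : ℝ) (u : TangentSpace (𝓡 m) q) :
    TangentSpace (𝓡∂ (m + 1)) (Φ t q) :=
  a • collarVelocity ε Φ t q + mfderiv (𝓡 m) (𝓡∂ (m + 1)) (Φ t) q u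

/-- `Φ : [0, ε) × M → X` is the embedding `(t, q) ↦ exp_q(t ν)` defined by the geodesic normal flow
of `g` from the boundary: a smooth open embedding whose curves `t ↦ Φ t q` are the geodesics of `g`
that start at `ι q` with the inner unit normal as initial velocity. Only the values `Φ t q`
with `0 ≤ t < ε` matter. -/
structure IsNormalCollar (g : SmoothMetric (m + 1) X) (ι : M → X) (ε : ℝ) (Φ : ℝ → M → X) : Prop where
  pos : 0 < ε
  smooth : ContMDiffOn (𝓘(ℝ, ℝ).prod (𝓡 m)) (𝓡∂ (m + 1)) ∞
    (fun z : ℝ × M ↦ Φ z.1 z.2) (Ico 0 ε ×ˢ univ)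
  isOpenEmbedding : Topology.IsOpenEmbedding
    ((Ico (0 : ℝ) ε ×ˢ (univ : Set M)).domRestrict fun z : ℝ × M ↦ Φ z.1 z.2)
  immersive : ∀ t ∈ Ico 0 ε, ∀ (q : M) (a : ℝ) (u : TangentSpace (𝓡 m) q),
    collarDeriv ε Φ t q a u = 0 → a = 0 ∧ u = 0
  initial_point : ∀ q, Φ 0 q = ι q
  initial_velocity : ∀ q, IsInnerUnitNormal g ι q (show Eu (m + 1) from collarVelocity ε Φ 0 q)
  geodesic : ∀ q, IsGeodesicOn g (fun t ↦ Φ t q) (Ico 0 ε)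

/-- `g₀` equals `dt² + h` near `M`, where `h = ι^* g` and `t` is the first coordinate of the
collar `Φ : [0, ε) × M → X`. -/
def EqProductNearBoundary (g₀ g : SmoothMetric (m + 1) X) (ι : M → X) (ε : ℝ) (Φ : ℝ → M → X) : Prop :=
  ∃ δ : ℝ, 0 < δ ∧ δ ≤ ε ∧ ∀ t ∈ Ico 0 δ, ∀ (q : M) (a b : ℝ) (u v : TangentSpace (𝓡 m) q),
    g₀.inner (Φ t q) (collarDeriv ε Φ t q a u) (collarDeriv ε Φ t q b v)
      = a * b + inducedMetric g ι q u v

end Boundary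

end Transgression

end

/-! Along $M$ split $TX|_M=\mathbb{R}\nu\oplus TM$. Near $M$ the metric $g_0$ is $dt^2+h$, so
$\nabla^0$ preserves the splitting on tangential directions. The metric $g$ has the same values
along $M$ and geodesic normal lines, so the two first jets differ only in the tangential part of
$\partial_t g$. Hence $\theta$ is off-diagonal on $TM$: $\theta(u)\nu=Au$ and
$\theta(u)w=-II(u,w)\nu$, where $II=\frac12\partial_t g$ is symmetric and $A$ is its $h$-adjoint
(`theta_tangential`, `metric_theta_normal`).

Write $R^s=R^0+s\,d^{\nabla^0}\theta+s^2\,\theta\wedge\theta$. The linear term is off-diagonal and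
the others are diagonal. So on $TM$ the off-diagonal blocks of $R^s$ are $s$ times those of $R^1$,
and the tangential block is that of $R^1$ plus $(s^2-1)\,\theta\wedge\theta$
(`curvatureOf_segment`). When the Weyl tensor vanishes, $R^1$ is a Kulkarni-Nomizu product, so every
block is a sum of products of 1-forms built from $h$, the Schouten tensor and $II$.

The symmetry of these bilinear forms gives $\sum_i B(\cdot,c_i)\wedge c^i=0$ for a basis $c_i$ of
$T_pM$. This kills the normal row and column of $(R^s)^2$, hence of every higher power. As $\theta$
is off-diagonal, $\mathrm{tr}(\theta (R^s)^l)$ sees only that row and column. The power $l=0$ is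
trivial, and $l=1$ follows from the symmetry of $II$ (`trace_mul_aeval_eq_zero`,
`pullbackForms_trForm_eq_zero`).

The remaining work carries the chart-based tensors to coordinates
$[0,\varepsilon)\times\mathbb{R}^m$ of the collar (`christoffelOf_pullback`, `curvatureOf_pullback`)
and checks there the properties collected in `IsProductPair`. -/

noncomputable section

namespace Transgression

/-! ### Matrices of exterior forms and the algebraic vanishing argument -/

section FormAlgebra

variable {U V : Type*} [AddCommGroup U] [Module ℝ U] [AddCommGroup V] [Module ℝ V]

/-- Matrices of forms on `U` representing the pull-backs along `f` of `End V`-valued forms. -/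
def formMatrix {J : Type*} [Fintype J] [DecidableEq J] (f : U →ₗ[ℝ] V) (v : Module.Basis J ℝ V) :
    EndForms V →ₐ[ℝ] Matrix J J (Forms U) :=
  (matrixEquivTensor J ℝ (Forms U)).symm.toAlgHom.comp
    (Algebra.TensorProduct.map (pullbackForms f) (LinearMap.toMatrixAlgEquiv v).toAlgHom)

theorem formMatrix_tmul {J : Type*} [Fintype J] [DecidableEq J] (f : U →ₗ[ℝ] V)
    (v : Module.Basis J ℝ V) (α : Forms V) (B : Module.End ℝ V) (x y : J) :
    formMatrix f v (α ⊗ₜ[ℝ] B) x y = v.coord x (B (v y)) • pullbackForms f α := by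
  have : formMatrix f v (α ⊗ₜ[ℝ] B) = (matrixEquivTensor J ℝ (Forms U)).symm
      (pullbackForms f α ⊗ₜ[ℝ] LinearMap.toMatrixAlgEquiv v B) := rfl
  rw [this, matrixEquivTensor_apply_symm]
  simp only [Matrix.smul_apply, Matrix.map_apply, LinearMap.toMatrixAlgEquiv_apply, smul_eq_mul,
    Module.Basis.coord_apply, ← Algebra.commutes, Algebra.smul_def]

/-- Since `formMatrix` is an algebra homomorphism, this turns the claim into a matrix trace over
`Forms U`. Only the form arguments are restricted to `U`; the endomorphisms still act on all of `V`.
-/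
theorem trace_formMatrix {J : Type*} [Fintype J] [DecidableEq J] (f : U →ₗ[ℝ] V)
    (v : Module.Basis J ℝ V) (x : EndForms V) :
    Matrix.trace (formMatrix f v x) = pullbackForms f (trForm x) := by
  induction x using TensorProduct.induction_on with
  | zero => simp
  | add x y hx hy => simp only [map_add, Matrix.trace_add, hx, hy]
  | tmul α B =>
    rw [trForm_tmul, map_smul, Matrix.trace]
    simp only [Matrix.diag_apply, formMatrix_tmul, ← Finset.sum_smul]
    rw [LinearMap.trace_eq_matrix_trace ℝ v, Matrix.trace]
    simp [LinearMap.toMatrix_apply]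

theorem pullbackForms_ι (f : U →ₗ[ℝ] V) (ξ : Module.Dual ℝ V) :
    pullbackForms f (ExteriorAlgebra.ι ℝ ξ) = ExteriorAlgebra.ι ℝ (ξ ∘ₗ f) := by
  simp only [pullbackForms, ExteriorAlgebra.map_apply_ι]
  rfl

theorem formMatrix_oneForm {J : Type*} [Fintype J] [DecidableEq J] {n : ℕ} (f : U →ₗ[ℝ] V)
    (v : Module.Basis J ℝ V) (b : Module.Basis (Fin n) ℝ V) (T : V →ₗ[ℝ] Module.End ℝ V) (x y : J) :
    formMatrix f v (oneForm b T) x y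
      = ExteriorAlgebra.ι ℝ ((v.coord x ∘ₗ T.flip (v y)) ∘ₗ f) := by
  simp only [oneForm, map_sum, Matrix.sum_apply, formMatrix_tmul, pullbackForms_ι]
  rw [← b.sum_dual_apply_smul_coord (v.coord x ∘ₗ T.flip (v y))]
  have hcomp : ∀ (a : Fin n → ℝ), (∑ i, a i • b.coord i) ∘ₗ f = ∑ i, a i • (b.coord i ∘ₗ f) := by
    intro a
    ext u
    simp
  rw [hcomp]
  simp

/-- The exterior form `∑ᵢⱼ r(cᵢ, cⱼ) cⁱ ∧ cʲ`. -/
def wedgeForm {m : ℕ} (c : Module.Basis (Fin m) ℝ U) (r : U → U → ℝ) : Forms U :=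
  ∑ i, ∑ j, r (c i) (c j) • (ExteriorAlgebra.ι ℝ (c.coord i) * ExteriorAlgebra.ι ℝ (c.coord j))

theorem wedgeForm_mul {m : ℕ} (c : Module.Basis (Fin m) ℝ U) (l μ : Module.Dual ℝ U) :
    wedgeForm c (fun u v ↦ l u * μ v) = ExteriorAlgebra.ι ℝ l * ExteriorAlgebra.ι ℝ μ := by
  conv_rhs => rw [← c.sum_dual_apply_smul_coord l, ← c.sum_dual_apply_smul_coord μ]
  simp only [wedgeForm, map_sum, map_smul, Finset.sum_mul, Finset.mul_sum, smul_mul_smul_comm]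
  rw [Finset.sum_comm]

theorem ι_eq_zero {l : Module.Dual ℝ U} (h : ∀ u, l u = 0) : ExteriorAlgebra.ι ℝ l = 0 := by
  rw [show l = 0 from LinearMap.ext h, map_zero]

theorem wedgeForm_mul_swap {m : ℕ} (c : Module.Basis (Fin m) ℝ U) (l μ : Module.Dual ℝ U) :
    wedgeForm c (fun u v ↦ l v * μ u) = - (ExteriorAlgebra.ι ℝ l * ExteriorAlgebra.ι ℝ μ) := by
  have : (fun u v ↦ l v * μ u) = fun u v ↦ μ u * l v := by ext; ring
  rw [this, wedgeForm_mul, eq_neg_iff_add_eq_zero, ExteriorAlgebra.ι_add_mul_swap]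

theorem wedgeForm_add {m : ℕ} (c : Module.Basis (Fin m) ℝ U) (r r' : U → U → ℝ) :
    wedgeForm c (fun u v ↦ r u v + r' u v) = wedgeForm c r + wedgeForm c r' := by
  simp only [wedgeForm, add_smul, Finset.sum_add_distrib]

theorem wedgeForm_sub {m : ℕ} (c : Module.Basis (Fin m) ℝ U) (r r' : U → U → ℝ) :
    wedgeForm c (fun u v ↦ r u v - r' u v) = wedgeForm c r - wedgeForm c r' := by
  simp only [wedgeForm, sub_smul, Finset.sum_sub_distrib]

/-- The factor $\frac12$ appears because `wedgeForm` sums over ordered pairs; this is how products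
of 1-forms are recognised from their values. -/
theorem half_wedgeForm_mul_sub {m : ℕ} (c : Module.Basis (Fin m) ℝ U) (l μ : Module.Dual ℝ U) :
    (1 / 2 : ℝ) • wedgeForm c (fun u v ↦ l u * μ v - l v * μ u)
      = ExteriorAlgebra.ι ℝ l * ExteriorAlgebra.ι ℝ μ := by
  rw [wedgeForm_sub, wedgeForm_mul_swap, wedgeForm_mul, sub_neg_eq_add, ← two_smul ℝ, smul_smul]
  norm_num

theorem wedgeForm_smul {m : ℕ} (c : Module.Basis (Fin m) ℝ U) (a : ℝ) (r : U → U → ℝ) :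
    wedgeForm c (fun u v ↦ a * r u v) = a • wedgeForm c r := by
  simp only [wedgeForm, Finset.smul_sum, smul_smul]

theorem wedgeForm_sum {m : ℕ} {J : Type*} (c : Module.Basis (Fin m) ℝ U) (t : Finset J)
    (r : J → U → U → ℝ) :
    wedgeForm c (fun u v ↦ ∑ k ∈ t, r k u v) = ∑ k ∈ t, wedgeForm c (r k) := by
  simp only [wedgeForm, Finset.sum_smul]
  rw [Finset.sum_comm]
  conv_rhs => rw [Finset.sum_comm]; enter [2, i]; rw [Finset.sum_comm]
  conv_lhs => rw [Finset.sum_comm]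

theorem wedgeForm_of_symm {m : ℕ} (c : Module.Basis (Fin m) ℝ U) (r : U → U → ℝ)
    (hr : ∀ u v, r u v = r v u) : wedgeForm c r = 0 := by
  have h : wedgeForm c r + wedgeForm c r = 0 := by
    conv_lhs => enter [2]; rw [wedgeForm, Finset.sum_comm]
    rw [wedgeForm]
    simp only [← Finset.sum_add_distrib]
    refine Finset.sum_eq_zero fun i _ ↦ Finset.sum_eq_zero fun j _ ↦ ?_
    rw [hr (c j), ← smul_add, ExteriorAlgebra.ι_add_mul_swap, smul_zero]
  rw [← two_smul ℝ] at h
  simpa using h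

/-- If `B(u, T v)` is symmetric in `u`, `v`, then `∑ᵢ B(·, cᵢ) ∧ cⁱ(T ·) = 0`. -/
theorem sum_ι_mul_ι_eq_zero {m : ℕ} (c : Module.Basis (Fin m) ℝ U) (B : U →ₗ[ℝ] U →ₗ[ℝ] ℝ)
    (T : U →ₗ[ℝ] U) (h : ∀ u v, B u (T v) = B v (T u)) :
    ∑ i, ExteriorAlgebra.ι ℝ (B.flip (c i)) * ExteriorAlgebra.ι ℝ (c.coord i ∘ₗ T) = 0 := by
  simp only [← wedgeForm_mul c, ← wedgeForm_sum]
  apply wedgeForm_of_symm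
  -- Expanding `T v` in the basis shows that the sum is the 2-form with symmetric coefficient
  -- function $B(u,Tv)$.
  have key : ∀ u v, ∑ i, (B.flip (c i)) u * (c.coord i ∘ₗ T) v = B u (T v) := by
    intro u v
    conv_rhs => rw [← c.sum_repr (T v)]
    simp only [map_sum, map_smul, smul_eq_mul, LinearMap.comp_apply, LinearMap.flip_apply,
      Module.Basis.coord_apply, mul_comm]
  intro u v
  rw [key, key, h]

/-- Both tensor factors change sign under $i\leftrightarrow j$, so the summands are symmetric, and
they vanish on the diagonal. -/
theorem two_smul_twoForm {n : ℕ} (b : Module.Basis (Fin n) ℝ V) (R : V →ₗ[ℝ] V →ₗ[ℝ] Module.End ℝ V)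
    (hR : ∀ u v, R u v = - R v u) :
    (2 : ℝ) • twoForm b (fun u v ↦ R u v) = ∑ i, ∑ j,
      (ExteriorAlgebra.ι ℝ (b.coord i) * ExteriorAlgebra.ι ℝ (b.coord j)) ⊗ₜ[ℝ] R (b i) (b j) := by
  set F : Fin n → Fin n → EndForms V := fun i j ↦
    (ExteriorAlgebra.ι ℝ (b.coord i) * ExteriorAlgebra.ι ℝ (b.coord j)) ⊗ₜ[ℝ] R (b i) (b j) with hF
  have hsymm : ∀ i j, F i j = F j i := by
    intro i j
    simp only [hF]
    rw [hR (b i), eq_neg_of_add_eq_zero_left (ExteriorAlgebra.ι_add_mul_swap (b.coord i) (b.coord j)),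
      TensorProduct.neg_tmul, TensorProduct.tmul_neg, neg_neg]
  have hdiag : ∀ i, F i i = 0 := by
    intro i
    simp only [hF, ExteriorAlgebra.ι_sq_zero, TensorProduct.zero_tmul]
  have h1 : ∑ i, ∑ j, F i j = ∑ i, (∑ j ∈ Finset.Ioi i, F i j + ∑ j ∈ Finset.Iio i, F i j) := by
    refine Finset.sum_congr rfl fun i _ ↦ ?_
    rw [← Finset.sum_union]
    · symm
      refine Finset.sum_subset (Finset.subset_univ _) fun j _ hj ↦ ?_
      have : j = i := by
        simp only [Finset.mem_union, Finset.mem_Ioi, Finset.mem_Iio] at hj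
        omega
      rw [this, hdiag]
    · rw [Finset.disjoint_left]
      intro j hj
      simp only [Finset.mem_Ioi, Finset.mem_Iio] at hj ⊢
      omega
  have h2 : ∑ i, ∑ j ∈ Finset.Iio i, F i j = ∑ i, ∑ j ∈ Finset.Ioi i, F i j := by
    rw [Finset.sum_comm' (t' := Finset.univ) (s' := fun j ↦ Finset.Ioi j)]
    · exact Finset.sum_congr rfl fun i _ ↦ Finset.sum_congr rfl fun j _ ↦ hsymm _ _
    · simp
  rw [h1, Finset.sum_add_distrib, h2, two_smul]
  rfl

/-- The sum over all ordered pairs does not depend on a basis, so the basis `b` of `V` can be traded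
for any basis `c` of `U`. -/
theorem formMatrix_twoForm {J : Type*} [Fintype J] [DecidableEq J] {n m : ℕ} (f : U →ₗ[ℝ] V)
    (v : Module.Basis J ℝ V) (b : Module.Basis (Fin n) ℝ V) (c : Module.Basis (Fin m) ℝ U)
    (R : V →ₗ[ℝ] V →ₗ[ℝ] Module.End ℝ V) (hR : ∀ u v, R u v = - R v u) (x y : J) :
    formMatrix f v (twoForm b (fun u v ↦ R u v)) x y
      = (1 / 2 : ℝ) • wedgeForm c (fun u u' ↦ v.coord x (R (f u) (f u') (v y))) := by
  have h2 : (2 : ℝ) • formMatrix f v (twoForm b (fun u v ↦ R u v)) x y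
      = wedgeForm c (fun u u' ↦ v.coord x (R (f u) (f u') (v y))) := by
    rw [← Matrix.smul_apply, ← map_smul, two_smul_twoForm b R hR]
    simp only [map_sum, Matrix.sum_apply, formMatrix_tmul, map_mul, pullbackForms_ι]
    simp only [← wedgeForm_mul c, ← wedgeForm_smul, ← wedgeForm_sum]
    congr 1
    ext u u'
    conv_rhs => rw [← b.sum_repr (f u), ← b.sum_repr (f u')]
    simp only [map_sum, map_smul, LinearMap.sum_apply, LinearMap.smul_apply, smul_eq_mul,
      LinearMap.comp_apply, Module.Basis.coord_apply, Finset.mul_sum]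
    rw [Finset.sum_comm]
    refine Finset.sum_congr rfl fun i _ ↦ Finset.sum_congr rfl fun j _ ↦ ?_
    ring
  rw [← h2, smul_smul]
  norm_num

/-- The index `.inl ()` is the normal direction. An off-diagonal `Θ` pairs only with the normal row
and column of a power of `ℛ`. From the square on these vanish, because $ℛ^{l+2}$ equals both
$ℛ^lℛ^2$ and $ℛ^2ℛ^l$; the ring `A` need not be commutative. -/
theorem trace_mul_aeval_eq_zero {A : Type*} [Ring A] [Algebra ℝ A] {m : ℕ}
    (Θ ℛ : Matrix (Unit ⊕ Fin m) (Unit ⊕ Fin m) A) (h00 : Θ (.inl ()) (.inl ()) = 0)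
    (hij : ∀ i j, Θ (.inr i) (.inr j) = 0)
    (hcol : ∀ x, (ℛ * ℛ) x (.inl ()) = 0) (hrow : ∀ x, (ℛ * ℛ) (.inl ()) x = 0)
    (h1 : ∑ i, Θ (.inl ()) (.inr i) * ℛ (.inr i) (.inl ()) = 0)
    (h2 : ∑ i, Θ (.inr i) (.inl ()) * ℛ (.inl ()) (.inr i) = 0) (Q : Polynomial ℝ) :
    Matrix.trace (Θ * Polynomial.aeval ℛ Q) = 0 := by
  have tr : ∀ N : Matrix (Unit ⊕ Fin m) (Unit ⊕ Fin m) A, Matrix.trace (Θ * N)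
      = ∑ i, Θ (.inl ()) (.inr i) * N (.inr i) (.inl ())
        + ∑ i, Θ (.inr i) (.inl ()) * N (.inl ()) (.inr i) := by
    intro N
    simp [Matrix.trace, Matrix.mul_apply, h00, hij]
  have pow : ∀ l : ℕ, Matrix.trace (Θ * ℛ ^ l) = 0 := by
    intro l
    match l with
    | 0 => rw [tr]; simp
    | 1 => rw [tr, pow_one, h1, h2, add_zero]
    | l + 2 =>
      have c : ∀ x, (ℛ ^ (l + 2)) x (.inl ()) = 0 := by
        intro x
        rw [pow_add, pow_two, Matrix.mul_apply]
        simp [hcol]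
      have r : ∀ x, (ℛ ^ (l + 2)) (.inl ()) x = 0 := by
        intro x
        rw [add_comm, pow_add, pow_two, Matrix.mul_apply]
        simp [hrow]
      rw [tr]
      simp [c, r]
  induction Q using Polynomial.induction_on' with
  | add p q hp hq => rw [map_add, mul_add, Matrix.trace_add, hp, hq, add_zero]
  | monomial l a =>
    rw [Polynomial.aeval_monomial, ← Algebra.smul_def, mul_smul_comm, Matrix.trace_smul, pow, smul_zero]

/-- Vanishing of `tr(θ Q(R))` on a hyperplane `U` of `ℝ × U`, when `θ` is off-diagonal with symmetric
second fundamental form `II` and shape operator `A`, and the curvature `R` has the given shape. -/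
theorem pullbackForms_trForm_eq_zero {n m : ℕ} (b : Module.Basis (Fin n) ℝ V)
    (c : Module.Basis (Fin m) ℝ U) (D : (ℝ × U) ≃ₗ[ℝ] V) (f : U →ₗ[ℝ] V)
    (T : V →ₗ[ℝ] Module.End ℝ V) (R : V →ₗ[ℝ] V →ₗ[ℝ] Module.End ℝ V)
    (hR : ∀ u v, R u v = - R v u) (h S II : U →ₗ[ℝ] U →ₗ[ℝ] ℝ) (h_symm : ∀ u v, h u v = h v u)
    (S_symm : ∀ u v, S u v = S v u) (II_symm : ∀ u v, II u v = II v u) (A P : U →ₗ[ℝ] U)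
    (hA : ∀ u v, h u (A v) = II u v) (hP : ∀ u v, h u (P v) = S u v) (β : U →ₗ[ℝ] ℝ) (s κ : ℝ)
    (hT : ∀ u a w, T (f u) (D (a, w)) = D (- II u w, a • A u))
    (hRN : ∀ u v, R (f u) (f v) (D (1, 0)) = D (0, s • (β v • u - β u • v)))
    (hRT : ∀ u v w, R (f u) (f v) (D (0, w)) = D (s * (β u * h v w - β v * h u w),
      h v w • P u - h u w • P v + (S v w • u - S u w • v)
        + κ • (II u w • A v - II v w • A u)))
    (Q : Polynomial ℝ) :
    pullbackForms f (trForm (oneForm b T * Polynomial.aeval (twoForm b (fun u v ↦ R u v)) Q)) = 0 := by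
  -- A basis adapted to the splitting: the normal vector `D (1, 0)`, then the tangent vectors `D (0,
  -- c i)`.
  let v : Module.Basis (Unit ⊕ Fin m) ℝ V := ((Module.Basis.singleton Unit ℝ).prod c).map D
  have vl : v (.inl ()) = D (1, 0) := by simp [v]
  have vr : ∀ i, v (.inr i) = D (0, c i) := by simp [v]
  have cl : ∀ a w, v.coord (.inl ()) (D (a, w)) = a := by intro a w; simp [v]
  have cr : ∀ i a w, v.coord (.inr i) (D (a, w)) = c.coord i w := by intro i a w; simp [v]
  rw [← trace_formMatrix f v, map_mul, ← Polynomial.aeval_algHom_apply]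
  set Θ := formMatrix f v (oneForm b T) with hΘ
  set ℛ := formMatrix f v (twoForm b (fun u v ↦ R u v)) with hℛ
  have Θ00 : Θ (.inl ()) (.inl ()) = 0 := by
    rw [hΘ, formMatrix_oneForm]
    apply ι_eq_zero
    intro u
    simp only [LinearMap.comp_apply, LinearMap.flip_apply, vl, hT, cl]
    simp
  have Θij : ∀ i j, Θ (.inr i) (.inr j) = 0 := by
    intro i j
    rw [hΘ, formMatrix_oneForm]
    apply ι_eq_zero
    intro u
    simp only [LinearMap.comp_apply, LinearMap.flip_apply, vr, hT, cr]
    simp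
  have Θ0j : ∀ j, Θ (.inl ()) (.inr j) = - ExteriorAlgebra.ι ℝ (II.flip (c j)) := by
    intro j
    rw [hΘ, formMatrix_oneForm, ← map_neg]
    congr 1
    ext u
    simp only [LinearMap.comp_apply, LinearMap.flip_apply, vr, hT, cl]
    simp
  have Θi0 : ∀ i, Θ (.inr i) (.inl ()) = ExteriorAlgebra.ι ℝ (c.coord i ∘ₗ A) := by
    intro i
    rw [hΘ, formMatrix_oneForm]
    congr 1
    ext u
    simp only [LinearMap.comp_apply, LinearMap.flip_apply, vl, hT, cr]
    simp
  have ℛ00 : ℛ (.inl ()) (.inl ()) = 0 := by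
    rw [hℛ, formMatrix_twoForm f v b c R hR]
    simp only [vl, hRN, cl]
    rw [wedgeForm_of_symm c _ (by simp), smul_zero]
  have ℛi0 : ∀ i, ℛ (.inr i) (.inl ()) = s • (ExteriorAlgebra.ι ℝ (c.coord i ∘ₗ LinearMap.id)
      * ExteriorAlgebra.ι ℝ β) := by
    intro i
    rw [hℛ, formMatrix_twoForm f v b c R hR]
    simp only [vl, hRN, cr]
    rw [← half_wedgeForm_mul_sub c, smul_comm, ← wedgeForm_smul c s]
    congr 2
    ext u u'
    simp only [map_smul, map_sub, smul_eq_mul, LinearMap.comp_apply, LinearMap.id_apply]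
    ring
  have ℛ0j : ∀ j, ℛ (.inl ()) (.inr j) = s • (ExteriorAlgebra.ι ℝ β
      * ExteriorAlgebra.ι ℝ (h.flip (c j))) := by
    intro j
    rw [hℛ, formMatrix_twoForm f v b c R hR]
    simp only [vr, hRT, cl]
    rw [wedgeForm_smul, smul_comm, ← half_wedgeForm_mul_sub c]
    rfl
  have ℛij : ∀ i j, ℛ (.inr i) (.inr j)
      = ExteriorAlgebra.ι ℝ (c.coord i ∘ₗ P) * ExteriorAlgebra.ι ℝ (h.flip (c j))
        + ExteriorAlgebra.ι ℝ (c.coord i ∘ₗ LinearMap.id) * ExteriorAlgebra.ι ℝ (S.flip (c j))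
        - κ • (ExteriorAlgebra.ι ℝ (c.coord i ∘ₗ A) * ExteriorAlgebra.ι ℝ (II.flip (c j))) := by
    intro i j
    rw [hℛ, formMatrix_twoForm f v b c R hR]
    simp only [vr, hRT, cr]
    simp only [← half_wedgeForm_mul_sub c]
    rw [smul_comm κ, ← wedgeForm_smul c κ, ← smul_add, ← smul_sub, ← wedgeForm_add, ← wedgeForm_sub]
    congr 2
    ext u u'
    simp only [map_smul, map_sub, map_add, smul_eq_mul, LinearMap.comp_apply, LinearMap.id_apply,
      LinearMap.flip_apply]
    ring
  -- The five contractions that occur below, each zero by the symmetry of `h`, `S` or `II`.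
  have hE := sum_ι_mul_ι_eq_zero c h LinearMap.id h_symm
  have tE := sum_ι_mul_ι_eq_zero c S LinearMap.id S_symm
  have aE := sum_ι_mul_ι_eq_zero c II LinearMap.id II_symm
  have hPz := sum_ι_mul_ι_eq_zero c h P (by simpa [hP] using S_symm)
  have hAz := sum_ι_mul_ι_eq_zero c h A (by simpa [hA] using II_symm)
  apply trace_mul_aeval_eq_zero Θ ℛ Θ00 Θij
  -- Normal column of the square: the last factor of each term in a block meets the factor $c^i$ of
  -- `ℛi0`.
  · have z : ∀ r : U →ₗ[ℝ] U →ₗ[ℝ] ℝ, ∑ i, ExteriorAlgebra.ι ℝ (r.flip (c i))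
        * ExteriorAlgebra.ι ℝ (c.coord i ∘ₗ LinearMap.id) = 0 → ∀ y,
        ∑ i, y * ExteriorAlgebra.ι ℝ (r.flip (c i))
          * (s • (ExteriorAlgebra.ι ℝ (c.coord i ∘ₗ LinearMap.id) * ExteriorAlgebra.ι ℝ β)) = 0 := by
      intro r hr y
      rw [← mul_zero y, ← zero_mul (s • ExteriorAlgebra.ι ℝ β), ← hr, Finset.sum_mul, Finset.mul_sum]
      exact Finset.sum_congr rfl fun i _ ↦ by simp only [mul_smul_comm, mul_assoc]
    rintro (x | x)
    · rw [Matrix.mul_apply, Fintype.sum_sum_type]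
      simp only [Finset.univ_unique, Finset.sum_singleton, PUnit.default_eq_unit, ℛ00, zero_mul,
        zero_add, ℛ0j, ℛi0]
      simpa only [smul_mul_assoc] using z h hE (s • ExteriorAlgebra.ι ℝ β)
    · rw [Matrix.mul_apply, Fintype.sum_sum_type]
      simp only [Finset.univ_unique, Finset.sum_singleton, PUnit.default_eq_unit, ℛ00, mul_zero,
        ℛij, ℛi0, add_mul, sub_mul, Finset.sum_add_distrib, Finset.sum_sub_distrib,
        z h hE, z S tE, ← smul_mul_assoc κ, z II aE, sub_zero, add_zero]
  -- Normal row of the square: the factor $h(\cdot,c_i)$ of `ℛ0j` meets the first factor of each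
  -- term, with `r` the identity, `P` or `A`.
  · have z : ∀ r : U →ₗ[ℝ] U, ∑ i, ExteriorAlgebra.ι ℝ (h.flip (c i))
        * ExteriorAlgebra.ι ℝ (c.coord i ∘ₗ r) = 0 → ∀ y,
        ∑ i, (s • (ExteriorAlgebra.ι ℝ β * ExteriorAlgebra.ι ℝ (h.flip (c i))))
          * (ExteriorAlgebra.ι ℝ (c.coord i ∘ₗ r) * y) = 0 := by
      intro r hr y
      rw [← mul_zero (s • ExteriorAlgebra.ι ℝ β), ← zero_mul y, ← hr, Finset.sum_mul, Finset.mul_sum]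
      exact Finset.sum_congr rfl fun i _ ↦ by simp only [smul_mul_assoc, mul_assoc]
    rintro (x | x)
    · rw [Matrix.mul_apply, Fintype.sum_sum_type]
      simp only [Finset.univ_unique, Finset.sum_singleton, PUnit.default_eq_unit, ℛ00, zero_mul,
        zero_add, ℛ0j, ℛi0, ← mul_smul_comm s _ (ExteriorAlgebra.ι ℝ β), z _ hE]
    · rw [Matrix.mul_apply, Fintype.sum_sum_type]
      simp only [Finset.univ_unique, Finset.sum_singleton, PUnit.default_eq_unit, ℛ00, zero_mul,
        ℛij, ℛ0j, mul_add, mul_sub, Finset.sum_add_distrib, Finset.sum_sub_distrib,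
        z _ hE, z _ hPz, ← mul_smul_comm κ, z _ hAz, sub_zero, add_zero]
  · have e : ∑ i, Θ (.inl ()) (.inr i) * ℛ (.inr i) (.inl ())
        = - (s • ((∑ i, ExteriorAlgebra.ι ℝ (II.flip (c i))
          * ExteriorAlgebra.ι ℝ (c.coord i ∘ₗ LinearMap.id)) * ExteriorAlgebra.ι ℝ β)) := by
      rw [Finset.sum_mul, Finset.smul_sum, ← Finset.sum_neg_distrib]
      exact Finset.sum_congr rfl fun i _ ↦ by rw [Θ0j, ℛi0, neg_mul, mul_smul_comm, mul_assoc]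
    rw [e, aE, zero_mul, smul_zero, neg_zero]
  · have comm : ∀ x y : Module.Dual ℝ U, ExteriorAlgebra.ι ℝ x * ExteriorAlgebra.ι ℝ y
        = - (ExteriorAlgebra.ι ℝ y * ExteriorAlgebra.ι ℝ x) :=
      fun x y ↦ eq_neg_of_add_eq_zero_left (ExteriorAlgebra.ι_add_mul_swap x y)
    -- Moving the 1-form $c^i\circ A$ past $\beta$ and $h(\cdot,c_i)$ costs two signs, which cancel.
    have e : ∑ i, Θ (.inr i) (.inl ()) * ℛ (.inl ()) (.inr i)
        = s • (ExteriorAlgebra.ι ℝ β * ∑ i, ExteriorAlgebra.ι ℝ (h.flip (c i))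
          * ExteriorAlgebra.ι ℝ (c.coord i ∘ₗ A)) := by
      rw [Finset.mul_sum, Finset.smul_sum]
      exact Finset.sum_congr rfl fun i _ ↦ by
        rw [Θi0, ℛ0j, mul_smul_comm, ← mul_assoc, comm _ β, neg_mul, mul_assoc,
          comm (c.coord i ∘ₗ A), mul_neg, neg_neg]
    rw [e, hAz, mul_zero, smul_zero]

end FormAlgebra

/-! ### Christoffel symbols and curvature under a change of coordinates -/

section CoordinateChange

open Filter

variable {E F : Type*} [NormedAddCommGroup E] [NormedSpace ℝ E] [NormedAddCommGroup F]
  [NormedSpace ℝ F]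

theorem metric_christoffelOf {G : E → E →L[ℝ] E →L[ℝ] ℝ} (H : Set E) {e : E}
    (hG : (G e).IsInvertible) (u v w : E) :
    G e (christoffelOf G H e u v) w = 1 / 2 * koszul G H e u v w := by
  rw [christoffelOf_apply, map_smul, hG.self_apply_inverse]
  rfl

theorem contDiffWithinAt_christoffelOf [CompleteSpace E] {G : E → E →L[ℝ] E →L[ℝ] ℝ} {H : Set E}
    {e : E} (hG : ContDiffWithinAt ℝ ∞ G H e) (hinv : (G e).IsInvertible) (hH : UniqueDiffOn ℝ H)
    (he : e ∈ H) : ContDiffWithinAt ℝ ∞ (christoffelOf G H) H e := by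
  have hD : ContDiffWithinAt ℝ ∞ (fderivWithin ℝ G H) H e :=
    hG.fderivWithin_right hH (by simp) he
  have hDf : ContDiffWithinAt ℝ ∞ (fun e ↦ (fderivWithin ℝ G H e).flip) H e :=
    (ContinuousLinearMap.flipₗᵢ ℝ E E (E →L[ℝ] ℝ)).contDiff.contDiffAt.comp_contDiffWithinAt e hD
  have hK : ContDiffWithinAt ℝ ∞ (koszul G H) H e := by
    apply (hD.add hDf).sub
    exact contDiffWithinAt_const.clm_comp hDf
  have hI : ContDiffWithinAt ℝ ∞ (fun e ↦ (G e).inverse) H e :=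
    (hinv.contDiffAt_map_inverse).comp_contDiffWithinAt e hG
  have hC : ContDiffWithinAt ℝ ∞
      (fun e ↦ ContinuousLinearMap.compL ℝ E (E →L[ℝ] ℝ) E (G e).inverse) H e :=
    (ContinuousLinearMap.compL ℝ E (E →L[ℝ] ℝ) E).contDiff.contDiffAt.comp_contDiffWithinAt e hI
  exact (hC.clm_comp hK).const_smul _

theorem fderivWithin_eval₂ {V W Z : Type*} [NormedAddCommGroup V] [NormedSpace ℝ V]
    [NormedAddCommGroup W] [NormedSpace ℝ W] [NormedAddCommGroup Z] [NormedSpace ℝ Z]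
    {G : E → V →L[ℝ] W →L[ℝ] Z} {H : Set E} {e : E} (hG : DifferentiableWithinAt ℝ G H e)
    (hH : UniqueDiffWithinAt ℝ H e) (c : E) (a : V) (b : W) :
    fderivWithin ℝ G H e c a b = fderivWithin ℝ (fun y ↦ G y a b) H e c := by
  rw [fderivWithin_clm_apply hH (hG.clm_apply (differentiableWithinAt_const a))
      (differentiableWithinAt_const b),
    fderivWithin_clm_apply hH hG (differentiableWithinAt_const a)]
  simp

theorem fderivWithin_apply_symm {V Z : Type*} [NormedAddCommGroup V] [NormedSpace ℝ V]
    [NormedAddCommGroup Z] [NormedSpace ℝ Z] {G : E → V →L[ℝ] V →L[ℝ] Z} {H : Set E} {e : E}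
    (hG : DifferentiableWithinAt ℝ G H e) (hH : UniqueDiffWithinAt ℝ H e)
    (hs : ∀ e u v, G e u v = G e v u) (c : E) (u v : V) :
    fderivWithin ℝ G H e c u v = fderivWithin ℝ G H e c v u := by
  rw [fderivWithin_eval₂ hG hH, fderivWithin_eval₂ hG hH]
  simp only [hs _ u v]

theorem koszul_symm {G : E → E →L[ℝ] E →L[ℝ] ℝ} {H : Set E} {e : E}
    (hG : DifferentiableWithinAt ℝ G H e) (hH : UniqueDiffWithinAt ℝ H e)
    (hs : ∀ e u v, G e u v = G e v u) (u v : E) :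
    koszul G H e u v = koszul G H e v u := by
  ext w
  have hsymm := fderivWithin_apply_symm hG hH hs
  rw [koszul_apply, koszul_apply, hsymm w u v]
  ring

theorem christoffelOf_symm {G : E → E →L[ℝ] E →L[ℝ] ℝ} {H : Set E} {e : E}
    (hG : DifferentiableWithinAt ℝ G H e) (hH : UniqueDiffWithinAt ℝ H e)
    (hs : ∀ e u v, G e u v = G e v u) (u v : E) :
    christoffelOf G H e u v = christoffelOf G H e v u := by
  rw [christoffelOf_apply, christoffelOf_apply, koszul_symm hG hH hs]

variable {φ : F → E} {H : Set E} {S : Set F} {z : F}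

/-- One-sided second derivatives at a boundary point are symmetric because the point is a limit of
interior points. -/
theorem symm_fderivWithin_fderivWithin {V : Type*} [NormedAddCommGroup V] [NormedSpace ℝ V]
    {ψ : F → V} (hψ : ContDiffWithinAt ℝ ∞ ψ S z) (hS : UniqueDiffOn ℝ S)
    (hz : z ∈ S) (hzc : z ∈ closure (interior S)) (a b : F) :
    fderivWithin ℝ (fderivWithin ℝ ψ S) S z a b = fderivWithin ℝ (fderivWithin ℝ ψ S) S z b a := by
  have h2 : minSmoothness ℝ 2 ≤ ∞ := by
    rw [minSmoothness_of_isRCLikeNormedField]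
    exact WithTop.coe_le_coe.2 (le_top : (2 : ℕ∞) ≤ ⊤)
  exact hψ.isSymmSndFDerivWithinAt h2 hS hzc hz a b

/-- Transformation law of Christoffel symbols: if `Ĝ = φ^* G` then
`Dφ(Γ̂(a, b)) = Γ(Dφ a, Dφ b) + D²φ(a, b)`. -/
theorem christoffelOf_pullback {G : E → E →L[ℝ] E →L[ℝ] ℝ} {G' : F → F →L[ℝ] F →L[ℝ] ℝ}
    (hS : UniqueDiffOn ℝ S) (hz : z ∈ S) (hzc : z ∈ closure (interior S))
    (hφ : ContDiffWithinAt ℝ ∞ φ S z) (hφH : Tendsto φ (𝓝[S] z) (𝓝[H] (φ z)))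
    (hG : DifferentiableWithinAt ℝ G H (φ z)) (hG' : DifferentiableWithinAt ℝ G' S z)
    (hH : UniqueDiffWithinAt ℝ H (φ z))
    (hs : ∀ e u v, G e u v = G e v u)
    (hpull : ∀ᶠ y in 𝓝[S] z, ∀ a b,
      G' y a b = G (φ y) (fderivWithin ℝ φ S y a) (fderivWithin ℝ φ S y b))
    (hinv : (G (φ z)).IsInvertible) (hinv' : (G' z).IsInvertible)
    (hD : Function.Surjective (fderivWithin ℝ φ S z)) (a b : F) :
    fderivWithin ℝ φ S z (christoffelOf G' S z a b)
      = christoffelOf G H (φ z) (fderivWithin ℝ φ S z a) (fderivWithin ℝ φ S z b)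
        + fderivWithin ℝ (fderivWithin ℝ φ S) S z a b := by
  have hDφ : DifferentiableWithinAt ℝ (fderivWithin ℝ φ S) S z :=
    (hφ.fderivWithin_right (m := ∞) hS (by simp) hz).differentiableWithinAt (by simp)
  set D := fderivWithin ℝ φ S z with hDdef
  set D2 := fderivWithin ℝ (fderivWithin ℝ φ S) S z with hD2def
  have hD2s : ∀ a b, D2 a b = D2 b a := symm_fderivWithin_fderivWithin hφ hS hz hzc
  have key : ∀ c a b, fderivWithin ℝ G' S z c a b = fderivWithin ℝ G H (φ z) (D c) (D a) (D b)
      + G (φ z) (D2 c a) (D b) + G (φ z) (D a) (D2 c b) := by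
    intro c a b
    rw [fderivWithin_eval₂ hG' (hS z hz)]
    have h1 : HasFDerivWithinAt (fun y ↦ G (φ y)) (fderivWithin ℝ G H (φ z) ∘L D) S z :=
      HasFDerivWithinAt.comp_of_tendsto z hG.hasFDerivWithinAt
        (hφ.differentiableWithinAt (by simp)).hasFDerivWithinAt hφH
    have h2 : ∀ a, HasFDerivWithinAt (fun y ↦ fderivWithin ℝ φ S y a) (D2.flip a) S z := by
      intro a
      simpa using hDφ.hasFDerivWithinAt.clm_apply (hasFDerivWithinAt_const a z S)
    have h3 := (h1.clm_apply (h2 a)).clm_apply (h2 b)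
    have h4 : (fun y ↦ G' y a b) =ᶠ[𝓝[S] z]
        fun y ↦ G (φ y) (fderivWithin ℝ φ S y a) (fderivWithin ℝ φ S y b) := by
      filter_upwards [hpull] with y hy using hy a b
    rw [h4.fderivWithin_eq (hpull.self_of_nhdsWithin hz a b), h3.fderivWithin (hS z hz)]
    simp [← hDdef]
    ring
  have hsymm : ∀ c u v, fderivWithin ℝ G H (φ z) c u v = fderivWithin ℝ G H (φ z) c v u :=
    fderivWithin_apply_symm hG hH hs
  -- By nondegeneracy it suffices to pair with vectors $D\varphi(c)$. In the Koszul combination all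
  -- second-derivative terms cancel except $2\,G(D^2\varphi(a,b),D\varphi(c))$.
  apply hinv.injective
  ext w
  obtain ⟨c, rfl⟩ := hD w
  rw [← hpull.self_of_nhdsWithin hz, metric_christoffelOf S hinv', map_add,
    add_apply, metric_christoffelOf H hinv, koszul_apply, koszul_apply]
  simp only [key]
  rw [hD2s c a, hD2s c b, hD2s b a, hs _ (D2 a c) (D b)]
  ring

/-- Transformation law of curvature: if the connections `d + Γ'` and `d + Γ` are related by `φ`
then `Dφ(R'(a, b) c) = R(Dφ a, Dφ b) Dφ c`. -/
theorem curvatureOf_pullback {Γ : E → E →L[ℝ] E →L[ℝ] E} {Γ' : F → F →L[ℝ] F →L[ℝ] F}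
    (hS : UniqueDiffOn ℝ S) (hz : z ∈ S) (hzc : z ∈ closure (interior S))
    (hφ : ContDiffWithinAt ℝ ∞ φ S z) (hφH : Tendsto φ (𝓝[S] z) (𝓝[H] (φ z)))
    (hΓ : DifferentiableWithinAt ℝ Γ H (φ z)) (hΓ' : DifferentiableWithinAt ℝ Γ' S z)
    (hlaw : ∀ᶠ y in 𝓝[S] z, ∀ a b, fderivWithin ℝ φ S y (Γ' y a b)
      = Γ (φ y) (fderivWithin ℝ φ S y a) (fderivWithin ℝ φ S y b)
        + fderivWithin ℝ (fderivWithin ℝ φ S) S y a b) (a b c : F) :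
    fderivWithin ℝ φ S z (curvatureOf Γ' S z a b c)
      = curvatureOf Γ H (φ z) (fderivWithin ℝ φ S z a) (fderivWithin ℝ φ S z b)
        (fderivWithin ℝ φ S z c) := by
  have hDφ : ContDiffWithinAt ℝ ∞ (fderivWithin ℝ φ S) S z :=
    hφ.fderivWithin_right (m := ∞) hS (by simp) hz
  have hD2φ : ContDiffWithinAt ℝ ∞ (fderivWithin ℝ (fderivWithin ℝ φ S) S) S z :=
    hDφ.fderivWithin_right (m := ∞) hS (by simp) hz
  have hlawz := hlaw.self_of_nhdsWithin hz
  have hD3s := symm_fderivWithin_fderivWithin hDφ hS hz hzc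
  have hD2s := symm_fderivWithin_fderivWithin hφ hS hz hzc
  set D := fderivWithin ℝ φ S z with hDdef
  set D2 := fderivWithin ℝ (fderivWithin ℝ φ S) S z with hD2def
  set D3 := fderivWithin ℝ (fderivWithin ℝ (fderivWithin ℝ φ S) S) S z with hD3def
  -- The derivative of the transformation law in direction `d`; this is why the law is needed near
  -- `z` and not only at `z`.
  have key : ∀ d a b, D2 d (Γ' z a b) + D (fderivWithin ℝ Γ' S z d a b)
      = fderivWithin ℝ Γ H (φ z) (D d) (D a) (D b) + Γ (φ z) (D2 d a) (D b)
        + Γ (φ z) (D a) (D2 d b) + D3 d a b := by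
    intro d a b
    have h1 : HasFDerivWithinAt (fun y ↦ Γ (φ y)) (fderivWithin ℝ Γ H (φ z) ∘L D) S z :=
      HasFDerivWithinAt.comp_of_tendsto z hΓ.hasFDerivWithinAt
        (hφ.differentiableWithinAt (by simp)).hasFDerivWithinAt hφH
    have h2 : ∀ a, HasFDerivWithinAt (fun y ↦ fderivWithin ℝ φ S y a) (D2.flip a) S z := by
      intro a
      simpa using (hDφ.differentiableWithinAt (by simp)).hasFDerivWithinAt.clm_apply
        (hasFDerivWithinAt_const a z S)
    have h3 := (h1.clm_apply (h2 a)).clm_apply (h2 b)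
    have h4 := (((hD2φ.differentiableWithinAt (by simp)).hasFDerivWithinAt.clm_apply
        (hasFDerivWithinAt_const a z S)).clm_apply (hasFDerivWithinAt_const b z S))
    have h5 := (hDφ.differentiableWithinAt (by simp)).hasFDerivWithinAt.clm_apply
      ((hΓ'.hasFDerivWithinAt.clm_apply
        (hasFDerivWithinAt_const a z S)).clm_apply (hasFDerivWithinAt_const b z S))
    have h6 := (h3.add h4).congr_of_eventuallyEq (f₁ := fun y ↦ fderivWithin ℝ φ S y (Γ' y a b))
      (by filter_upwards [hlaw] with y hy using hy a b) (hlawz a b)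
    have h7 := congrArg (fun L ↦ L d) ((hS z hz).eq h5 h6)
    simp [← hDdef, ← hD2def, ← hD3def] at h7
    rw [add_comm, h7]
    abel
  have e1 := key a b c
  have e2 := key b a c
  -- After antisymmetrising in `a`, `b`, the third derivatives of `φ` drop out, and the law itself
  -- (`l1`, `l2`) absorbs the remaining second derivatives.
  rw [hD3s b a, hD2s b a] at e2
  have l1 := hlawz a (Γ' z b c)
  have l2 := hlawz b (Γ' z a c)
  rw [hlawz b c, map_add] at l1
  rw [hlawz a c, map_add] at l2
  rw [curvatureOf_apply, curvatureOf_apply, map_add, map_sub, map_sub, l1, l2,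
    eq_sub_of_add_eq' e1, eq_sub_of_add_eq' e2]
  abel

end CoordinateChange

/-! ### Geometry along the boundary of the half-space $[0,\infty)\times U$ -/

section BoundaryCoordinates

open Filter

variable {U : Type*} [NormedAddCommGroup U] [NormedSpace ℝ U]

variable (U) in
/-- The half-space `[0, ∞) × U`. -/
abbrev halfSpace : Set (ℝ × U) := Ici 0 ×ˢ univ

theorem uniqueDiffOn_halfSpace : UniqueDiffOn ℝ (halfSpace U) :=
  (uniqueDiffOn_Ici 0).prod uniqueDiffOn_univ

omit [NormedSpace ℝ U] in
theorem mem_closure_interior_halfSpace {z : ℝ × U} (hz : z ∈ halfSpace U) :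
    z ∈ closure (interior (halfSpace U)) := by
  rw [interior_prod_eq, closure_prod_eq, interior_Ici, closure_Ioi]
  simpa using hz

variable {Z : Type*} [NormedAddCommGroup Z] [NormedSpace ℝ Z]

theorem fderivWithin_halfSpace_tangential {G : ℝ × U → Z} {y : U}
    (hG : DifferentiableWithinAt ℝ G (halfSpace U) (0, y)) (u : U) :
    fderivWithin ℝ G (halfSpace U) (0, y) (0, u) = fderiv ℝ (fun y' ↦ G (0, y')) y u := by
  have h1 : HasFDerivWithinAt (fun y' : U ↦ ((0 : ℝ), y')) (ContinuousLinearMap.inr ℝ ℝ U) univ y :=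
    (hasFDerivWithinAt_const (0 : ℝ) y univ).prodMk (hasFDerivWithinAt_id y univ)
  have h2 := HasFDerivWithinAt.comp (t := halfSpace U) y hG.hasFDerivWithinAt h1 (fun _ _ ↦ by simp)
  rw [hasFDerivWithinAt_univ] at h2
  have h3 := h2.fderiv
  simp only [Function.comp_def] at h3
  rw [h3]
  simp

theorem fderivWithin_halfSpace_normal {G : ℝ × U → Z} {y : U}
    (hG : DifferentiableWithinAt ℝ G (halfSpace U) (0, y)) :
    fderivWithin ℝ G (halfSpace U) (0, y) (1, 0) = derivWithin (fun t ↦ G (t, y)) (Ici 0) 0 := by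
  have h1 : HasFDerivWithinAt (fun t : ℝ ↦ (t, y)) (ContinuousLinearMap.inl ℝ ℝ U) (Ici 0) 0 :=
    (hasFDerivWithinAt_id (0 : ℝ) _).prodMk (hasFDerivWithinAt_const y 0 _)
  have h2 := HasFDerivWithinAt.comp (t := halfSpace U) (0 : ℝ) hG.hasFDerivWithinAt h1
    (fun t ht ↦ by simpa using ht)
  have h3 := h2.hasDerivWithinAt.derivWithin ((uniqueDiffOn_Ici (0 : ℝ)) 0 self_mem_Ici)
  simp only [Function.comp_def] at h3
  rw [h3]
  simp

/-- If a component of `Γ(0, y)(a)(b)` vanishes along the boundary, then so do its tangential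
derivatives. -/
theorem fderivWithin_eq_zero_of_boundary {Γ : ℝ × U → ℝ × U →L[ℝ] ℝ × U →L[ℝ] ℝ × U} {y : U}
    (hΓ : DifferentiableWithinAt ℝ Γ (halfSpace U) (0, y)) (L : ℝ × U →L[ℝ] Z) (a b : ℝ × U)
    (h : ∀ᶠ y' in 𝓝 y, L (Γ (0, y') a b) = 0) (u : U) :
    L (fderivWithin ℝ Γ (halfSpace U) (0, y) (0, u) a b) = 0 := by
  have hy : ((0 : ℝ), y) ∈ halfSpace U := by simp
  have hd : DifferentiableWithinAt ℝ (fun z ↦ Γ z a b) (halfSpace U) (0, y) :=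
    (hΓ.clm_apply (differentiableWithinAt_const a)).clm_apply (differentiableWithinAt_const b)
  have h1 : L (fderivWithin ℝ Γ (halfSpace U) (0, y) (0, u) a b)
      = fderivWithin ℝ (fun z ↦ L (Γ z a b)) (halfSpace U) (0, y) (0, u) := by
    rw [fderivWithin_eval₂ hΓ (uniqueDiffOn_halfSpace _ hy)]
    have := (L.hasFDerivAt.comp_hasFDerivWithinAt _ hd.hasFDerivWithinAt).fderivWithin
      (uniqueDiffOn_halfSpace _ hy)
    simp only [Function.comp_def] at this
    rw [this]
    rfl
  have hLd : DifferentiableWithinAt ℝ (fun z ↦ L (Γ z a b)) (halfSpace U) (0, y) :=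
    L.differentiableAt.comp_differentiableWithinAt _ hd
  rw [h1, fderivWithin_halfSpace_tangential hLd]
  have h2 : (fun y' ↦ L (Γ (0, y') a b)) =ᶠ[𝓝 y] fun _ ↦ 0 := h
  rw [h2.fderiv_eq]
  simp

/-- At a point `(0, y)` of the boundary of `[0, ∞) × U`: the metric `G₀` is `dt² + h` nearby, `G₁`
agrees with it along the boundary, and `∂_t` is geodesic for `G₁` there. -/
structure IsProductPair (G₀ G₁ : ℝ × U → ℝ × U →L[ℝ] ℝ × U →L[ℝ] ℝ) (y : U) : Prop where
  diff₀ : DifferentiableWithinAt ℝ G₀ (halfSpace U) (0, y)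
  diff₁ : DifferentiableWithinAt ℝ G₁ (halfSpace U) (0, y)
  symm₀ : ∀ z a b, G₀ z a b = G₀ z b a
  symm₁ : ∀ z a b, G₁ z a b = G₁ z b a
  inv₀ : (G₀ (0, y)).IsInvertible
  boundary : ∀ᶠ y' in 𝓝 y, G₁ (0, y') = G₀ (0, y')
  normal : ∀ᶠ z in 𝓝[halfSpace U] (0, y), ∀ a, G₀ z a (1, 0) = a.1
  static : ∀ᶠ t in 𝓝[≥] (0 : ℝ), G₀ (t, y) = G₀ (0, y)
  geodesic : christoffelOf G₁ (halfSpace U) (0, y) (1, 0) (1, 0) = 0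

namespace IsProductPair

variable {G₀ G₁ : ℝ × U → ℝ × U →L[ℝ] ℝ × U →L[ℝ] ℝ} {y : U}

omit [NormedAddCommGroup U] [NormedSpace ℝ U] in
theorem mem_halfSpace (y : U) : ((0 : ℝ), y) ∈ halfSpace U := by simp

theorem uniqueDiff (y : U) : UniqueDiffWithinAt ℝ (halfSpace U) ((0 : ℝ), y) :=
  uniqueDiffOn_halfSpace _ (mem_halfSpace y)

theorem eq_boundary (h : IsProductPair G₀ G₁ y) : G₁ (0, y) = G₀ (0, y) :=
  h.boundary.self_of_nhds

theorem inv₁ (h : IsProductPair G₀ G₁ y) : (G₁ (0, y)).IsInvertible := by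
  rw [h.eq_boundary]; exact h.inv₀

theorem apply_normal (h : IsProductPair G₀ G₁ y) (a : ℝ × U) : G₀ (0, y) a (1, 0) = a.1 :=
  h.normal.self_of_nhdsWithin (mem_halfSpace y) a

theorem normal_apply (h : IsProductPair G₀ G₁ y) (a : ℝ × U) : G₀ (0, y) (1, 0) a = a.1 := by
  rw [h.symm₀, h.apply_normal]

theorem deriv_normal (h : IsProductPair G₀ G₁ y) (w a : ℝ × U) :
    fderivWithin ℝ G₀ (halfSpace U) (0, y) w a (1, 0) = 0 := by
  rw [fderivWithin_eval₂ h.diff₀ (uniqueDiff y)]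
  have : (fun z ↦ G₀ z a (1, 0)) =ᶠ[𝓝[halfSpace U] (0, y)] fun _ ↦ a.1 := by
    filter_upwards [h.normal] with z hz using hz a
  rw [this.fderivWithin_eq (h.apply_normal a)]
  simp

theorem deriv_normal' (h : IsProductPair G₀ G₁ y) (w a : ℝ × U) :
    fderivWithin ℝ G₀ (halfSpace U) (0, y) w (1, 0) a = 0 := by
  rw [fderivWithin_apply_symm h.diff₀ (uniqueDiff y) h.symm₀, h.deriv_normal]

theorem normal_deriv (h : IsProductPair G₀ G₁ y) :
    fderivWithin ℝ G₀ (halfSpace U) (0, y) (1, 0) = 0 := by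
  rw [fderivWithin_halfSpace_normal h.diff₀]
  have : (fun t ↦ G₀ (t, y)) =ᶠ[𝓝[≥] (0 : ℝ)] fun _ ↦ G₀ (0, y) := h.static
  rw [this.derivWithin_eq rfl]
  simp

theorem tangential_deriv (h : IsProductPair G₀ G₁ y) (u : U) :
    fderivWithin ℝ G₁ (halfSpace U) (0, y) (0, u)
      = fderivWithin ℝ G₀ (halfSpace U) (0, y) (0, u) := by
  rw [fderivWithin_halfSpace_tangential h.diff₀, fderivWithin_halfSpace_tangential h.diff₁]
  have : (fun y' ↦ G₁ (0, y')) =ᶠ[𝓝 y] fun y' ↦ G₀ (0, y') := h.boundary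
  rw [this.fderiv_eq]

/-- The metrics agree along the boundary and $\partial_tG_0=0$, so the first jets differ only by
$\partial_tG_1$, which therefore determines `θ`. -/
theorem deriv_eq (h : IsProductPair G₀ G₁ y) (x : ℝ × U) :
    fderivWithin ℝ G₁ (halfSpace U) (0, y) x = fderivWithin ℝ G₀ (halfSpace U) (0, y) x
      + x.1 • fderivWithin ℝ G₁ (halfSpace U) (0, y) (1, 0) := by
  have hx : x = (0, x.2) + x.1 • ((1 : ℝ), (0 : U)) := by ext <;> simp
  conv_lhs => rw [hx, map_add, map_smul, h.tangential_deriv]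
  conv_rhs => enter [1]; rw [hx, map_add, map_smul, h.normal_deriv, smul_zero, add_zero]

/-- `G(θ(x) w, v)` for `θ = Γ₁ - Γ₀` at the boundary. -/
theorem metric_theta (h : IsProductPair G₀ G₁ y) (x w v : ℝ × U) :
    G₀ (0, y) ((christoffelOf G₁ (halfSpace U) (0, y) - christoffelOf G₀ (halfSpace U) (0, y)) x w) v
      = 1 / 2 * (x.1 * fderivWithin ℝ G₁ (halfSpace U) (0, y) (1, 0) w v
        + w.1 * fderivWithin ℝ G₁ (halfSpace U) (0, y) (1, 0) x v
        - v.1 * fderivWithin ℝ G₁ (halfSpace U) (0, y) (1, 0) x w) := by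
  rw [sub_apply, sub_apply, map_sub,
    sub_apply, metric_christoffelOf _ h.inv₀, ← h.eq_boundary,
    metric_christoffelOf _ h.inv₁, koszul_apply, koszul_apply, h.deriv_eq x, h.deriv_eq w,
    h.deriv_eq v]
  simp
  ring

/-- For $dt^2+h$ the field $\partial_t$ is parallel: each Koszul term is a derivative of a constant
coefficient or a $t$-derivative. -/
theorem christoffel_normal (h : IsProductPair G₀ G₁ y) (x : ℝ × U) :
    christoffelOf G₀ (halfSpace U) (0, y) x (1, 0) = 0 := by
  apply h.inv₀.injective
  refine ContinuousLinearMap.ext fun v ↦ ?_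
  rw [metric_christoffelOf _ h.inv₀, koszul_apply, h.deriv_normal, h.deriv_normal', h.normal_deriv]
  simp

theorem christoffel_fst (h : IsProductPair G₀ G₁ y) (x w : ℝ × U) :
    (christoffelOf G₀ (halfSpace U) (0, y) x w).1 = 0 := by
  rw [← h.apply_normal, metric_christoffelOf _ h.inv₀, koszul_apply, h.deriv_normal,
    h.deriv_normal, h.normal_deriv]
  simp

/-- The normal derivative of `G₁` is tangential, by the geodesic equation. -/
theorem normal_deriv_normal (h : IsProductPair G₀ G₁ y) (v : ℝ × U) :
    fderivWithin ℝ G₁ (halfSpace U) (0, y) (1, 0) (1, 0) v = 0 := by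
  -- Both connections annihilate $(\partial_t,\partial_t)$, so $\theta(\partial_t)\partial_t=0$.
  -- Evaluating at $v=\partial_t$ first removes the second term.
  have h1 : ∀ v, 2 * fderivWithin ℝ G₁ (halfSpace U) (0, y) (1, 0) (1, 0) v
      - v.1 * fderivWithin ℝ G₁ (halfSpace U) (0, y) (1, 0) (1, 0) (1, 0) = 0 := by
    intro v
    have := h.metric_theta (1, 0) (1, 0) v
    rw [sub_apply, sub_apply, h.geodesic,
      h.christoffel_normal] at this
    simp only [sub_zero, map_zero, zero_apply] at this
    linarith
  have h2 := h1 (1, 0)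
  have h3 := h1 v
  have h4 : fderivWithin ℝ G₁ (halfSpace U) (0, y) (1, 0) (1, 0) (1, 0) = 0 := by
    simp only at h2
    linarith
  rw [h4] at h3
  linarith

theorem normal_deriv_symm (h : IsProductPair G₀ G₁ y) (a b : ℝ × U) :
    fderivWithin ℝ G₁ (halfSpace U) (0, y) (1, 0) a b
      = fderivWithin ℝ G₁ (halfSpace U) (0, y) (1, 0) b a :=
  fderivWithin_apply_symm h.diff₁ (uniqueDiff y) h.symm₁ _ _ _

theorem theta_normal_fst (h : IsProductPair G₀ G₁ y) (x : ℝ × U) :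
    ((christoffelOf G₁ (halfSpace U) (0, y) - christoffelOf G₀ (halfSpace U) (0, y)) x (1, 0)).1
      = 0 := by
  rw [← h.apply_normal, h.metric_theta, h.normal_deriv_symm x, h.normal_deriv_normal]
  simp only
  ring

theorem theta_tangential (h : IsProductPair G₀ G₁ y) (u w : U) :
    (christoffelOf G₁ (halfSpace U) (0, y) - christoffelOf G₀ (halfSpace U) (0, y)) (0, u) (0, w)
      = (- (1 / 2 * fderivWithin ℝ G₁ (halfSpace U) (0, y) (1, 0) (0, u) (0, w)), 0) := by
  apply h.inv₀.injective
  refine ContinuousLinearMap.ext fun v ↦ ?_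
  have e : ∀ r : ℝ, G₀ (0, y) (r, 0) v = r * v.1 := by
    intro r
    rw [show ((r, 0) : ℝ × U) = r • ((1 : ℝ), (0 : U)) by simp, map_smul, smul_apply,
      h.normal_apply, smul_eq_mul]
  rw [h.metric_theta, e]
  simp only
  ring

theorem metric_theta_normal (h : IsProductPair G₀ G₁ y) (u : U) (v : ℝ × U) :
    G₀ (0, y) ((christoffelOf G₁ (halfSpace U) (0, y) - christoffelOf G₀ (halfSpace U) (0, y))
      (0, u) (1, 0)) v = 1 / 2 * fderivWithin ℝ G₁ (halfSpace U) (0, y) (1, 0) (0, u) v := by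
  rw [h.metric_theta, h.normal_deriv_symm (0, u) (1, 0), h.normal_deriv_normal (0, u)]
  simp only
  ring

end IsProductPair

/-- Curvature of `∇⁰ + s θ` on tangential vectors, when `∇⁰` splits and `θ` is off-diagonal along
the boundary. -/
theorem curvatureOf_segment {Γ θ : ℝ × U → ℝ × U →L[ℝ] ℝ × U →L[ℝ] ℝ × U} {y : U}
    (hΓ : DifferentiableWithinAt ℝ Γ (halfSpace U) (0, y))
    (hθ : DifferentiableWithinAt ℝ θ (halfSpace U) (0, y))
    (Γ_normal : ∀ᶠ y' in 𝓝 y, ∀ u, Γ (0, y') (0, u) (1, 0) = 0)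
    (Γ_fst : ∀ᶠ y' in 𝓝 y, ∀ u w, (Γ (0, y') (0, u) w).1 = 0)
    (θ_normal : ∀ᶠ y' in 𝓝 y, ∀ u, (θ (0, y') (0, u) (1, 0)).1 = 0)
    (θ_tangential : ∀ᶠ y' in 𝓝 y, ∀ u w, (θ (0, y') (0, u) (0, w)).2 = 0) (s : ℝ) (u v : U) :
    (∀ w, curvatureOf (fun z ↦ Γ z + s • θ z) (halfSpace U) (0, y) (0, u) (0, v) (0, w)
      = (s * (curvatureOf (fun z ↦ Γ z + θ z) (halfSpace U) (0, y) (0, u) (0, v) (0, w)).1,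
        (curvatureOf (fun z ↦ Γ z + θ z) (halfSpace U) (0, y) (0, u) (0, v) (0, w)).2
          + (s ^ 2 - 1) • (θ (0, y) (0, u) (θ (0, y) (0, v) (0, w))
            - θ (0, y) (0, v) (θ (0, y) (0, u) (0, w))).2)) ∧
    curvatureOf (fun z ↦ Γ z + s • θ z) (halfSpace U) (0, y) (0, u) (0, v) (1, 0)
      = (s ^ 2 * (θ (0, y) (0, u) (θ (0, y) (0, v) (1, 0))
            - θ (0, y) (0, v) (θ (0, y) (0, u) (1, 0))).1,
        s • (curvatureOf (fun z ↦ Γ z + θ z) (halfSpace U) (0, y) (0, u) (0, v) (1, 0)).2) := by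
  have ud := IsProductPair.uniqueDiff y
  have hD : ∀ s : ℝ, fderivWithin ℝ (fun z ↦ Γ z + s • θ z) (halfSpace U) (0, y)
      = fderivWithin ℝ Γ (halfSpace U) (0, y) + s • fderivWithin ℝ θ (halfSpace U) (0, y) := by
    intro s
    exact (hΓ.hasFDerivWithinAt.add (hθ.hasFDerivWithinAt.const_smul s)).fderivWithin ud
  -- Only tangential derivatives enter the curvature on tangential vectors, so block entries
  -- vanishing along the boundary contribute no derivative terms.
  have dΓ1 : ∀ u v w, (fderivWithin ℝ Γ (halfSpace U) (0, y) (0, u) (0, v) w).1 = 0 := fun u v w ↦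
    fderivWithin_eq_zero_of_boundary hΓ (ContinuousLinearMap.fst ℝ ℝ U) (0, v) w
      (Γ_fst.mono fun y' h ↦ h v w) u
  have dΓ0 : ∀ u v, fderivWithin ℝ Γ (halfSpace U) (0, y) (0, u) (0, v) (1, 0) = 0 := fun u v ↦
    fderivWithin_eq_zero_of_boundary hΓ (ContinuousLinearMap.id ℝ (ℝ × U)) (0, v) (1, 0)
      (Γ_normal.mono fun y' h ↦ h v) u
  have dθ1 : ∀ u v, (fderivWithin ℝ θ (halfSpace U) (0, y) (0, u) (0, v) (1, 0)).1 = 0 := fun u v ↦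
    fderivWithin_eq_zero_of_boundary hθ (ContinuousLinearMap.fst ℝ ℝ U) (0, v) (1, 0)
      (θ_normal.mono fun y' h ↦ h v) u
  have dθ2 : ∀ u v w, (fderivWithin ℝ θ (halfSpace U) (0, y) (0, u) (0, v) (0, w)).2 = 0 :=
    fun u v w ↦ fderivWithin_eq_zero_of_boundary hθ (ContinuousLinearMap.snd ℝ ℝ U) (0, v) (0, w)
      (θ_tangential.mono fun y' h ↦ h v w) u
  have gN := Γ_normal.self_of_nhds
  have g1 := Γ_fst.self_of_nhds
  have tN := θ_normal.self_of_nhds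
  have tT := θ_tangential.self_of_nhds
  -- The reference curvature is the case $s=1$. Off-diagonal terms are linear in $s$, and the
  -- diagonal ones of degree 0 or 2, whence the factors $s$, $s^2$ and $s^2-1$.
  have e1 : (fun z ↦ Γ z + θ z) = fun z ↦ Γ z + (1 : ℝ) • θ z := by simp
  rw [e1]
  obtain ⟨a, ha⟩ : ∃ a : U → U → U, ∀ u w, Γ (0, y) (0, u) (0, w) = (0, a u w) :=
    ⟨fun u w ↦ (Γ (0, y) (0, u) (0, w)).2, fun u w ↦ Prod.ext (g1 _ _) rfl⟩
  obtain ⟨b, hb⟩ : ∃ b : U → U → ℝ, ∀ u w, θ (0, y) (0, u) (0, w) = b u w • ((1 : ℝ), (0 : U)) :=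
    ⟨fun u w ↦ (θ (0, y) (0, u) (0, w)).1, fun u w ↦ Prod.ext (by simp) (by simp [tT])⟩
  obtain ⟨c, hc⟩ : ∃ c : U → U, ∀ u, θ (0, y) (0, u) (1, 0) = (0, c u) :=
    ⟨fun u ↦ (θ (0, y) (0, u) (1, 0)).2, fun u ↦ Prod.ext (tN _) rfl⟩
  refine ⟨fun w ↦ Prod.ext ?_ ?_, Prod.ext ?_ ?_⟩
  all_goals
    simp only [curvatureOf_apply, hD, add_apply, smul_apply, map_add, map_smul, ha, hb, hc, gN,
      Prod.fst_add, Prod.snd_add, Prod.fst_sub, Prod.snd_sub, Prod.smul_fst, Prod.smul_snd,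
      dΓ1, dΓ0, dθ1, dθ2, smul_eq_mul, smul_zero, add_zero, zero_add, mul_zero,
      sub_zero]
  · ring
  · module
  · ring
  · module

end BoundaryCoordinates

/-! ### Vanishing of the transgression form in collar coordinates -/

section CollarTransgression

open Filter

theorem curvatureOf_neg_swap {E : Type*} [NormedAddCommGroup E] [NormedSpace ℝ E]
    (Γ : E → E →L[ℝ] E →L[ℝ] E) (S : Set E) (e u v : E) :
    curvatureOf Γ S e u v = - curvatureOf Γ S e v u := by
  refine ContinuousLinearMap.ext fun w ↦ ?_
  rw [neg_apply, curvatureOf_apply, curvatureOf_apply]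
  abel

/-- The first Bianchi identity for a torsion-free connection. -/
theorem curvatureOf_bianchi {E : Type*} [NormedAddCommGroup E] [NormedSpace ℝ E]
    {Γ : E → E →L[ℝ] E →L[ℝ] E} {S : Set E} {e : E} (hΓ : DifferentiableWithinAt ℝ Γ S e)
    (hS : UniqueDiffWithinAt ℝ S e) (he : e ∈ S)
    (hs : ∀ᶠ z in 𝓝[S] e, ∀ a b, Γ z a b = Γ z b a) (u v w : E) :
    curvatureOf Γ S e u v w + curvatureOf Γ S e v w u + curvatureOf Γ S e w u v = 0 := by
  have hsz := hs.self_of_nhdsWithin he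
  have hd : ∀ c a b, fderivWithin ℝ Γ S e c a b = fderivWithin ℝ Γ S e c b a := by
    intro c a b
    rw [fderivWithin_eval₂ hΓ hS, fderivWithin_eval₂ hΓ hS]
    have : (fun y ↦ Γ y a b) =ᶠ[𝓝[S] e] fun y ↦ Γ y b a := by
      filter_upwards [hs] with y hy using hy a b
    rw [this.fderivWithin_eq (hsz a b)]
  simp only [curvatureOf_apply]
  rw [hd u w v, hd v w u, hd w v u, hsz v w, hsz u w, hsz u v]
  abel

theorem isInvertible_of_pos {E : Type*} [NormedAddCommGroup E] [NormedSpace ℝ E]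
    [FiniteDimensional ℝ E] (B : E →L[ℝ] E →L[ℝ] ℝ) (hB : ∀ a, a ≠ 0 → 0 < B a a) :
    B.IsInvertible := by
  have inj : Function.Injective B := by
    rw [injective_iff_map_eq_zero]
    intro a ha
    by_contra h
    have := hB a h
    rw [ha] at this
    simp at this
  have fr : Module.finrank ℝ E = Module.finrank ℝ (E →L[ℝ] ℝ) := by
    rw [LinearEquiv.finrank_eq (LinearMap.toContinuousLinearMap (𝕜 := ℝ) (E := E) (F' := ℝ)).symm]
    exact (Subspace.dual_finrank_eq).symm
  let e := (LinearEquiv.ofInjectiveOfFinrankEq B.toLinearMap inj fr).toContinuousLinearEquiv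
  exact ⟨e, by ext; rfl⟩

variable {U V : Type*} [NormedAddCommGroup U] [NormedSpace ℝ U] [FiniteDimensional ℝ U]
  [AddCommGroup V] [Module ℝ V]

/-- Feeds the geometry of `IsProductPair` into the algebraic vanishing. The form `σ` plays the role
of the Schouten tensor; its symmetry is not assumed, and the part needed is deduced from the Bianchi
identity. -/
theorem pullbackForms_trForm_eq_zero_of_isProductPair {n m : ℕ} (b : Module.Basis (Fin n) ℝ V)
    (c : Module.Basis (Fin m) ℝ U) (D : (ℝ × U) ≃ₗ[ℝ] V) (f : U →ₗ[ℝ] V) (hf : ∀ u, f u = D (0, u))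
    (T : V →ₗ[ℝ] Module.End ℝ V) (R : V →ₗ[ℝ] V →ₗ[ℝ] Module.End ℝ V)
    (hR : ∀ u v, R u v = - R v u) {G₀ G₁ : ℝ × U → ℝ × U →L[ℝ] ℝ × U →L[ℝ] ℝ} {y : U}
    (hpair : ∀ᶠ y' in 𝓝 y, IsProductPair G₀ G₁ y')
    (hG₀ : ContDiffWithinAt ℝ ∞ G₀ (halfSpace U) (0, y))
    (hG₁ : ContDiffWithinAt ℝ ∞ G₁ (halfSpace U) (0, y))
    (hpos : ∀ a, a ≠ 0 → 0 < G₁ (0, y) a a) (s : ℝ)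
    (hT : ∀ a a', T (D a) (D a') = D ((christoffelOf G₁ (halfSpace U) (0, y)
      - christoffelOf G₀ (halfSpace U) (0, y)) a a'))
    (hRs : ∀ a a' a'', R (D a) (D a') (D a'') = D (curvatureOf (fun z ↦
      christoffelOf G₀ (halfSpace U) z + s • (christoffelOf G₁ (halfSpace U) z
        - christoffelOf G₀ (halfSpace U) z)) (halfSpace U) (0, y) a a' a''))
    (σ : ℝ × U →ₗ[ℝ] ℝ × U →ₗ[ℝ] ℝ)
    (hW : ∀ u₁ u₂ u₃ u₄, G₁ (0, y) (curvatureOf (christoffelOf G₁ (halfSpace U)) (halfSpace U) (0, y)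
        u₁ u₂ u₃) u₄ = σ u₁ u₄ * G₁ (0, y) u₂ u₃ + σ u₂ u₃ * G₁ (0, y) u₁ u₄
          - σ u₁ u₃ * G₁ (0, y) u₂ u₄ - σ u₂ u₄ * G₁ (0, y) u₁ u₃)
    (Q : Polynomial ℝ) :
    pullbackForms f (trForm (oneForm b T * Polynomial.aeval (twoForm b (fun u v ↦ R u v)) Q)) = 0 := by
  have hy : ((0 : ℝ), y) ∈ halfSpace U := by simp
  have hp := hpair.self_of_nhds
  have ud := uniqueDiffOn_halfSpace (U := U)
  have hinv : (G₁ (0, y)).IsInvertible := hp.inv₁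
  have hΓ₀ : DifferentiableWithinAt ℝ (christoffelOf G₀ (halfSpace U)) (halfSpace U) (0, y) :=
    (contDiffWithinAt_christoffelOf hG₀ hp.inv₀ ud hy).differentiableWithinAt (by simp)
  have hΓ₁ : DifferentiableWithinAt ℝ (christoffelOf G₁ (halfSpace U)) (halfSpace U) (0, y) :=
    (contDiffWithinAt_christoffelOf hG₁ hinv ud hy).differentiableWithinAt (by simp)
  have hsymm : ∀ᶠ z in 𝓝[halfSpace U] (0, y), ∀ a a', christoffelOf G₁ (halfSpace U) z a a'
      = christoffelOf G₁ (halfSpace U) z a' a := by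
    have h1 := (hG₁.of_le (m := 1) (by simp)).eventually (by simp)
    rw [insert_eq_of_mem hy] at h1
    filter_upwards [h1, self_mem_nhdsWithin] with z hz hzS
    exact christoffelOf_symm (hz.differentiableWithinAt (by simp)) (ud z hzS) hp.symm₁
  have bianchi := curvatureOf_bianchi hΓ₁ (ud _ hy) hy hsymm
  set Γ₀ := christoffelOf G₀ (halfSpace U) with hΓ₀def
  set Γ₁ := christoffelOf G₁ (halfSpace U) with hΓ₁def
  set G := G₁ (0, y) with hGdef
  have hG0 : G₀ (0, y) = G := hp.eq_boundary.symm
  have Gsymm : ∀ a a', G a a' = G a' a := hp.symm₁ _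
  have GN : ∀ a, G a (1, 0) = a.1 := by rw [← hG0]; exact hp.apply_normal
  have GN' : ∀ a, G (1, 0) a = a.1 := by rw [← hG0]; exact hp.normal_apply
  have split : ∀ z : ℝ × U, z = z.1 • ((1 : ℝ), (0 : U)) + (0, z.2) := by intro z; ext <;> simp
  have pair0 : ∀ r : ℝ, ((r, 0) : ℝ × U) = r • ((1 : ℝ), (0 : U)) := by intro r; simp
  let j : U →ₗ[ℝ] ℝ × U := LinearMap.inr ℝ ℝ U
  let h : U →ₗ[ℝ] U →ₗ[ℝ] ℝ := LinearMap.mk₂ ℝ (fun u w ↦ G (j u) (j w))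
    (by intros; simp) (by intros; simp) (by intros; simp) (by intros; simp)
  let K := fderivWithin ℝ G₁ (halfSpace U) (0, y) (1, 0)
  let II : U →ₗ[ℝ] U →ₗ[ℝ] ℝ := LinearMap.mk₂ ℝ (fun u w ↦ 1 / 2 * K (j u) (j w))
    (by intros; simp; ring) (by intros; simp; ring) (by intros; simp; ring) (by intros; simp; ring)
  let S : U →ₗ[ℝ] U →ₗ[ℝ] ℝ := σ.compl₁₂ j j
  let β : U →ₗ[ℝ] ℝ := σ.flip (1, 0) ∘ₗ j
  let A : U →ₗ[ℝ] U := (ContinuousLinearMap.snd ℝ ℝ U).toLinearMap ∘ₗ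
    ((Γ₁ (0, y) - Γ₀ (0, y)).flip (1, 0)).toLinearMap ∘ₗ j
  have Gsplit : ∀ a a', G a a' = a.1 * a'.1 + h a.2 a'.2 := by
    intro a a'
    conv_lhs => rw [split a, split a']
    simp only [map_add, add_apply, map_smul, smul_apply, GN, GN', smul_eq_mul]
    simp [h, j, mul_comm]
  -- The curvature is only evaluated on tangential `u₁`, `u₂`, so only a tangential first argument
  -- of `σ` matters in `RN` and `RT`.
  have σsplit : ∀ u a', σ (0, u) a' = a'.1 * β u + S u a'.2 := by
    intro u a'
    calc σ (0, u) a' = σ (0, u) (a'.1 • ((1 : ℝ), (0 : U)) + (0, a'.2)) := by rw [← split]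
      _ = a'.1 * β u + S u a'.2 := by rw [map_add, map_smul]; rfl
  have hsymm' : ∀ u v, h u v = h v u := fun u v ↦ Gsymm _ _
  have hII : ∀ u v, II u v = II v u := fun u v ↦ by
    simp only [II, K, LinearMap.mk₂_apply]
    rw [hp.normal_deriv_symm]
  have θN : ∀ u, (Γ₁ (0, y) - Γ₀ (0, y)) (0, u) (1, 0) = (0, A u) := fun u ↦
    Prod.ext (hp.theta_normal_fst _) rfl
  have θT : ∀ u w, (Γ₁ (0, y) - Γ₀ (0, y)) (0, u) (0, w) = (- II u w, 0) := fun u w ↦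
    hp.theta_tangential u w
  have hA : ∀ u v, h u (A v) = II u v := by
    intro u v
    have := hp.metric_theta_normal v (0, u)
    rw [hG0, θN, Gsplit] at this
    simp only [zero_mul, zero_add] at this
    rw [hsymm', hII]
    exact this
  have hS : ∀ u v, S u v = S v u := by
    intro u v
    -- In the cyclic sum over $(\nu,u,v)$ paired with $\nu$, all terms cancel except
    -- $S(u,v)-S(v,u)$.
    have := congrArg (fun x ↦ G x (1, 0)) (bianchi (1, 0) (0, u) (0, v))
    simp only [map_add, add_apply, map_zero, zero_apply, hW, Gsplit] at this
    simp only [hsymm' v u, LinearMap.zero_apply] at this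
    have e : ∀ u v, S u v = σ (0, u) (0, v) := fun _ _ ↦ rfl
    rw [e, e]
    linarith
  have hpos' : ∀ u, u ≠ 0 → 0 < h u u := fun u hu ↦ hpos (0, u) (by simpa using hu)
  -- The index of `S` is raised with the positive definite form `h`.
  obtain ⟨P, hP⟩ : ∃ P : U →ₗ[ℝ] U, ∀ u v, h u (P v) = S u v := by
    have inj : Function.Injective h := by
      rw [injective_iff_map_eq_zero]
      intro a ha
      by_contra hne
      have := hpos' a hne
      rw [ha] at this
      simp at this
    let e := LinearEquiv.ofInjectiveOfFinrankEq h inj (Subspace.dual_finrank_eq (K := ℝ)).symm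
    refine ⟨e.symm.toLinearMap ∘ₗ S, fun u v ↦ ?_⟩
    have h1 : h (e.symm (S v)) = S v := e.apply_symm_apply (S v)
    rw [hsymm', LinearMap.comp_apply, LinearEquiv.coe_coe, h1, hS]
  have RN : ∀ u v, curvatureOf Γ₁ (halfSpace U) (0, y) (0, u) (0, v) (1, 0)
      = (0, β v • u - β u • v) := by
    intro u v
    apply hinv.injective
    refine ContinuousLinearMap.ext fun d ↦ ?_
    rw [hW]
    simp only [Gsplit, σsplit, map_sub, map_smul, LinearMap.sub_apply, LinearMap.smul_apply,
      map_zero, smul_eq_mul]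
    ring
  have RT : ∀ u v w, curvatureOf Γ₁ (halfSpace U) (0, y) (0, u) (0, v) (0, w)
      = (β u * h v w - β v * h u w,
        h v w • P u - h u w • P v + (S v w • u - S u w • v)) := by
    intro u v w
    apply hinv.injective
    refine ContinuousLinearMap.ext fun d ↦ ?_
    rw [hW]
    simp only [Gsplit, σsplit, map_sub, map_add, map_smul, LinearMap.sub_apply, LinearMap.add_apply,
      LinearMap.smul_apply, smul_eq_mul, hsymm' (P _) d.2, hP, hS d.2]
    ring
  have seg := curvatureOf_segment (Γ := Γ₀) (θ := fun z ↦ Γ₁ z - Γ₀ z) hΓ₀ (hΓ₁.sub hΓ₀)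
    (hpair.mono fun y' h u ↦ h.christoffel_normal _)
    (hpair.mono fun y' h u w ↦ h.christoffel_fst _ _)
    (hpair.mono fun y' h u ↦ h.theta_normal_fst _)
    (hpair.mono fun y' h u w ↦ by rw [h.theta_tangential]) s
  simp only [add_sub_cancel] at seg
  refine pullbackForms_trForm_eq_zero b c D f T R hR h S II hsymm' hS hII A P hA hP β s (s ^ 2 - 1)
    ?_ ?_ ?_ Q
  · intro u a w
    rw [hf, hT, split (a, w)]
    rw [map_add, map_smul, θN, θT]
    exact congrArg D (Prod.ext (by simp) (by simp))
  · intro u v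
    -- The normal component cancels because both quadratic terms are $h(Au,Av)$ up to order.
    rw [hf, hf, hRs, (seg u v).2, RN, θN, θN, θT, θT, hII u, ← hA, hII v, ← hA, hsymm' (A u)]
    simp
  · intro u v w
    have θr : ∀ u r, (Γ₁ (0, y) - Γ₀ (0, y)) (0, u) (r, 0) = (0, r • A u) := by
      intro u r
      rw [pair0, map_smul, θN]
      simp
    rw [hf, hf, hRs, (seg u v).1, RT, θT, θT, θr, θr]
    simp [neg_add_eq_sub]

end CollarTransgression

/-! ### Smoothness and chart expressions of pulled-back metrics -/

section PullbackMetric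

open Filter

variable {n : ℕ} [NeZero n] {X : Type*} [TopologicalSpace X]
  [ChartedSpace (EuclideanHalfSpace n) X] [IsManifold (𝓡∂ n) ∞ X]
  {F : Type*} [NormedAddCommGroup F] [NormedSpace ℝ F]

/-- The pull-back of the metric `g` under a map `f` defined on a subset `s` of a vector space. -/
def pullbackMetric (g : SmoothMetric n X) (f : F → X) (s : Set F) (z : F) : F →L[ℝ] F →L[ℝ] ℝ :=
  let D : F →L[ℝ] Eu n := mfderivWithin 𝓘(ℝ, F) (𝓡∂ n) f s z
  let b : Eu n →L[ℝ] Eu n →L[ℝ] ℝ := g.inner (f z)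
  b.bilinearComp D D

theorem pullbackMetric_apply (g : SmoothMetric n X) (f : F → X) (s : Set F) (z a b : F) :
    pullbackMetric g f s z a b = g.inner (f z) (mfderivWithin 𝓘(ℝ, F) (𝓡∂ n) f s z a)
      (mfderivWithin 𝓘(ℝ, F) (𝓡∂ n) f s z b) := rfl

theorem metricInChart_eq_pullbackMetric (g : SmoothMetric n X) (x : X) :
    metricInChart g x = pullbackMetric g (extChartAt (𝓡∂ n) x).symm (range (𝓡∂ n)) := rfl

theorem pullbackMetric_symm (g : SmoothMetric n X) (f : F → X) (s : Set F) (z a b : F) :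
    pullbackMetric g f s z a b = pullbackMetric g f s z b a :=
  g.symm _ _ _

theorem pullbackMetric_pos (g : SmoothMetric n X) (f : F → X) (s : Set F) (z : F)
    (h : Function.Injective (mfderivWithin 𝓘(ℝ, F) (𝓡∂ n) f s z)) (a : F) (ha : a ≠ 0) :
    0 < pullbackMetric g f s z a a := by
  apply g.pos
  intro h0
  exact ha (h (h0.trans (map_zero (mfderivWithin 𝓘(ℝ, F) (𝓡∂ n) f s z)).symm))

/-- For constant `a` the tangent map makes $z\mapsto Df_z(a)$ a smooth section along `f`; evaluating
the smooth metric on two such sections gives the coefficients. -/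
theorem contDiffOn_pullbackMetric [FiniteDimensional ℝ F] (g : SmoothMetric n X) {f : F → X}
    {s : Set F} (hf : ContMDiffOn 𝓘(ℝ, F) (𝓡∂ n) ∞ f s) (hs : UniqueDiffOn ℝ s) :
    ContDiffOn ℝ ∞ (pullbackMetric g f s) s := by
  have htan : ∀ a : F, ContMDiffOn 𝓘(ℝ, F) ((𝓡∂ n).prod 𝓘(ℝ, Eu n)) ∞
      (fun z ↦ TotalSpace.mk' (Eu n) (E := (TangentSpace (𝓡∂ n) : X → Type _)) (f z)
        (mfderivWithin 𝓘(ℝ, F) (𝓡∂ n) f s z a)) s := by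
    intro a
    have h1 := hf.contMDiffOn_tangentMapWithin (m := ∞) (by simp) hs.uniqueMDiffOn
    have h2 : ContMDiff 𝓘(ℝ, F) (𝓘(ℝ, F).prod 𝓘(ℝ, F)) ∞
        (fun z : F ↦ (TotalSpace.mk' F (E := (TangentSpace 𝓘(ℝ, F) : F → Type _)) z a)) := by
      intro z
      rw [contMDiffAt_vectorSpace_iff_contDiffAt (V := fun _ ↦ a)]
      exact contDiffAt_const
    exact h1.comp h2.contMDiffOn (fun z hz ↦ hz)
  have hg : ContMDiffOn 𝓘(ℝ, F) ((𝓡∂ n).prod 𝓘(ℝ, Eu n →L[ℝ] Eu n →L[ℝ] ℝ)) ∞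
      (fun z ↦ TotalSpace.mk' (Eu n →L[ℝ] Eu n →L[ℝ] ℝ)
        (E := fun x ↦ (TangentSpace (𝓡∂ n) x →L[ℝ] TangentSpace (𝓡∂ n) x →L[ℝ] ℝ))
        (f z) (g.inner (f z))) s :=
    g.contMDiff.comp_contMDiffOn hf
  have key : ∀ a b : F, ContDiffOn ℝ ∞ (fun z ↦ pullbackMetric g f s z a b) s := by
    intro a b z hz
    have h := ContMDiffWithinAt.clm_bundle_apply₂ (F₃ := ℝ) (E₃ := Bundle.Trivial X ℝ)
      (hg z hz) (htan a z hz) (htan b z hz)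
    rw [contMDiffWithinAt_totalSpace] at h
    exact h.2.contDiffWithinAt
  rw [contDiffOn_clm_apply]
  intro a
  rw [contDiffOn_clm_apply]
  intro b
  exact key a b

theorem pullbackMetric_congr_set (g : SmoothMetric n X) {f : F → X} {s t : Set F} {z : F}
    (hf : MDifferentiableWithinAt 𝓘(ℝ, F) (𝓡∂ n) f t z) (hs : UniqueDiffWithinAt ℝ s z)
    (hst : t ∈ 𝓝[s] z) : pullbackMetric g f s z = pullbackMetric g f t z := by
  unfold pullbackMetric
  rw [hf.mfderivWithin_mono_of_mem_nhdsWithin hs.uniqueMDiffWithinAt hst]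

/-- If `f` is smooth on `t`, and `t` is a neighbourhood of `z` in `s`, then the pull-back computed
with derivatives in `s` is smooth at `z`. -/
theorem contDiffWithinAt_pullbackMetric [FiniteDimensional ℝ F] (g : SmoothMetric n X) {f : F → X}
    {s t : Set F} {z : F} (hf : ContMDiffOn 𝓘(ℝ, F) (𝓡∂ n) ∞ f t) (hs : UniqueDiffOn ℝ s)
    (ht : UniqueDiffOn ℝ t) (hts : t ⊆ s) (hz : z ∈ t) (hst : ∀ z ∈ t, t ∈ 𝓝[s] z) :
    ContDiffWithinAt ℝ ∞ (pullbackMetric g f s) s z := by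
  have h1 := (contDiffOn_pullbackMetric g hf ht z hz).mono_of_mem_nhdsWithin (hst z hz)
  have h2 : ∀ y ∈ t, pullbackMetric g f s y = pullbackMetric g f t y := fun y hy ↦
    pullbackMetric_congr_set g ((hf y hy).mdifferentiableWithinAt (by simp)) (hs y (hts hy))
      (hst y hy)
  apply h1.congr_of_eventuallyEq _ (h2 z hz)
  filter_upwards [hst z hz] with y hy using h2 y hy

theorem uniqueDiffOn_extChartAt_target (x : X) :
    UniqueDiffOn ℝ (extChartAt (𝓡∂ n) x).target := by
  have h := (uniqueMDiffOn_univ (I := 𝓡∂ n) (M := X)).uniqueDiffOn_target_inter x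
  simpa using h

theorem contDiffWithinAt_metricInChart (g : SmoothMetric n X) (x : X) {e : Eu n}
    (he : e ∈ (extChartAt (𝓡∂ n) x).target) :
    ContDiffWithinAt ℝ ∞ (metricInChart g x) (range (𝓡∂ n)) e :=
  contDiffWithinAt_pullbackMetric g (contMDiffOn_extChartAt_symm x) (𝓡∂ n).uniqueDiffOn
    (uniqueDiffOn_extChartAt_target x) (extChartAt_target_subset_range x) he
    (fun _ hz ↦ extChartAt_target_mem_nhdsWithin_of_mem hz)

theorem isInvertible_metricInChart (g : SmoothMetric n X) (x : X) {e : Eu n}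
    (he : e ∈ (extChartAt (𝓡∂ n) x).target) : (metricInChart g x e).IsInvertible :=
  isInvertible_of_pos _ (pullbackMetric_pos g _ _ e
    (isInvertible_mfderivWithin_extChartAt_symm he).injective)

theorem inner_congr (g : SmoothMetric n X) {q q' : X} (h : q = q') (a b : Eu n) :
    g.inner q a b = g.inner q' a b := by
  subst h
  rfl

/-- The tangent space at `x` is the model space through the preferred chart, so the inverse chart
has identity differential at the centre. -/
theorem metricInChart_self (g : SmoothMetric n X) (x : X) (a b : Eu n) :
    metricInChart g x (extChartAt (𝓡∂ n) x x) a b = g.inner x a b := by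
  have h : ∀ a : Eu n, mfderivWithin 𝓘(ℝ, Eu n) (𝓡∂ n) (extChartAt (𝓡∂ n) x).symm (range (𝓡∂ n))
      (extChartAt (𝓡∂ n) x x) a = a := fun a ↦
    congrArg (fun L : Eu n →L[ℝ] Eu n ↦ L a) (mfderivWithin_range_extChartAt_symm (I := 𝓡∂ n) (x := x))
  rw [metricInChart_eq_pullbackMetric, pullbackMetric_apply]
  erw [h, h]
  exact inner_congr g (extChartAt_to_inv x) a b

theorem pullbackMetric_eq_metricInChart (g : SmoothMetric n X) (x : X) {f : F → X} {s : Set F}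
    {z : F} (hf : MDifferentiableWithinAt 𝓘(ℝ, F) (𝓡∂ n) f s z) (hs : UniqueDiffWithinAt ℝ s z)
    (hx : f z ∈ (extChartAt (𝓡∂ n) x).source) (a b : F) :
    pullbackMetric g f s z a b = metricInChart g x (extChartAt (𝓡∂ n) x (f z))
      (fderivWithin ℝ (extChartAt (𝓡∂ n) x ∘ f) s z a)
      (fderivWithin ℝ (extChartAt (𝓡∂ n) x ∘ f) s z b) := by
  have h1 : fderivWithin ℝ (extChartAt (𝓡∂ n) x ∘ f) s z
      = (mfderiv (𝓡∂ n) 𝓘(ℝ, Eu n) (extChartAt (𝓡∂ n) x) (f z)).comp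
        (mfderivWithin 𝓘(ℝ, F) (𝓡∂ n) f s z) := by
    rw [← mfderivWithin_eq_fderivWithin]
    exact mfderiv_comp_mfderivWithin z (mdifferentiableAt_extChartAt (by simpa using hx)) hf
      hs.uniqueMDiffWithinAt
  have h2 := mfderivWithin_extChartAt_symm_comp_mfderiv_extChartAt' hx
  have h3 : ∀ c : F, mfderivWithin 𝓘(ℝ, Eu n) (𝓡∂ n) (extChartAt (𝓡∂ n) x).symm (range (𝓡∂ n))
      (extChartAt (𝓡∂ n) x (f z)) (fderivWithin ℝ (extChartAt (𝓡∂ n) x ∘ f) s z c)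
        = mfderivWithin 𝓘(ℝ, F) (𝓡∂ n) f s z c := by
    intro c
    rw [h1]
    exact congrArg (fun L : Eu n →L[ℝ] Eu n ↦ L (mfderivWithin 𝓘(ℝ, F) (𝓡∂ n) f s z c)) h2
  rw [metricInChart_eq_pullbackMetric, pullbackMetric_apply, pullbackMetric_apply]
  erw [h3, h3]
  exact (inner_congr g ((extChartAt (𝓡∂ n) x).left_inv hx) _ _).symm

end PullbackMetric

/-! ### The collar map in boundary coordinates and its differential -/

section Collar

open Filter

variable {m : ℕ} {X : Type*} [TopologicalSpace X] [ChartedSpace (EuclideanHalfSpace (m + 1)) X]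
  {M : Type*} [TopologicalSpace M] [ChartedSpace (EuclideanSpace ℝ (Fin m)) M]

/-- The collar map in the preferred chart of the boundary at `p`. -/
def collarChart (Φ : ℝ → M → X) (p : M) (z : ℝ × Eu m) : X :=
  Φ z.1 ((extChartAt (𝓡 m) p).symm z.2)

/-- The domain of definition of `collarChart`. -/
def collarDomain (ε : ℝ) (p : M) : Set (ℝ × Eu m) :=
  Ico 0 ε ×ˢ (extChartAt (𝓡 m) p).target

theorem isOpen_boundaryTarget (p : M) : IsOpen (extChartAt (𝓡 m) p).target :=
  isOpen_extChartAt_target p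

theorem collarDomain_mem_nhdsWithin {ε : ℝ} {p : M} {z : ℝ × Eu m} (hz : z ∈ collarDomain ε p) :
    collarDomain ε p ∈ 𝓝[halfSpace (Eu m)] z := by
  have : collarDomain ε p = halfSpace (Eu m) ∩ (Iio ε ×ˢ (extChartAt (𝓡 m) p).target) := by
    ext ⟨t, y⟩
    simp [collarDomain, and_assoc]
  rw [this]
  exact inter_mem_nhdsWithin _ ((isOpen_Iio.prod (isOpen_boundaryTarget p)).mem_nhds
    ⟨hz.1.2, hz.2⟩)

theorem collarDomain_subset (ε : ℝ) (p : M) : collarDomain ε p ⊆ halfSpace (Eu m) :=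
  fun _ hz ↦ ⟨hz.1.1, mem_univ _⟩

theorem uniqueDiffOn_collarDomain (ε : ℝ) (p : M) : UniqueDiffOn ℝ (collarDomain (m := m) ε p) :=
  (uniqueDiffOn_Ico 0 ε).prod (isOpen_boundaryTarget p).uniqueDiffOn

variable [IsManifold (𝓡∂ (m + 1)) ∞ X] [IsManifold (𝓡 m) ∞ M]

omit [IsManifold (𝓡∂ (m + 1)) ∞ X] in
theorem contMDiffOn_collarChart {ε : ℝ} {Φ : ℝ → M → X} (p : M)
    (hΦ : ContMDiffOn (𝓘(ℝ, ℝ).prod (𝓡 m)) (𝓡∂ (m + 1)) ∞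
      (fun z : ℝ × M ↦ Φ z.1 z.2) (Ico 0 ε ×ˢ univ)) :
    ContMDiffOn 𝓘(ℝ, ℝ × Eu m) (𝓡∂ (m + 1)) ∞ (collarChart Φ p) (collarDomain (m := m) ε p) := by
  have h1 : ContMDiffOn 𝓘(ℝ, ℝ × Eu m) 𝓘(ℝ, ℝ) ∞ (fun z : ℝ × Eu m ↦ z.1) (collarDomain (m := m) ε p) :=
    contDiff_fst.contMDiff.contMDiffOn
  have h2 : ContMDiffOn 𝓘(ℝ, ℝ × Eu m) 𝓘(ℝ, Eu m) ∞ (fun z : ℝ × Eu m ↦ z.2)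
    (collarDomain (m := m) ε p) := contDiff_snd.contMDiff.contMDiffOn
  have h3 : ContMDiffOn 𝓘(ℝ, ℝ × Eu m) (𝓡 m) ∞
      (fun z : ℝ × Eu m ↦ (extChartAt (𝓡 m) p).symm z.2) (collarDomain (m := m) ε p) :=
    (contMDiffOn_extChartAt_symm p).comp h2 (fun z hz ↦ hz.2)
  exact hΦ.comp (h1.prodMk h3) (fun z hz ↦ ⟨hz.1, mem_univ _⟩)

omit [IsManifold (𝓡∂ (m + 1)) ∞ X] in
theorem mdifferentiableWithinAt_collarChart {ε : ℝ} {Φ : ℝ → M → X} {p : M}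
    (hΦ : ContMDiffOn (𝓘(ℝ, ℝ).prod (𝓡 m)) (𝓡∂ (m + 1)) ∞
      (fun z : ℝ × M ↦ Φ z.1 z.2) (Ico 0 ε ×ˢ univ)) {z : ℝ × Eu m} (hz : z ∈ collarDomain (m := m) ε p) :
    MDifferentiableWithinAt 𝓘(ℝ, ℝ × Eu m) (𝓡∂ (m + 1)) (collarChart Φ p) (halfSpace (Eu m)) z :=
  ((contMDiffOn_collarChart p hΦ z hz).mdifferentiableWithinAt (by simp)).mono_of_mem_nhdsWithin
    (collarDomain_mem_nhdsWithin hz)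

omit [IsManifold (𝓡∂ (m + 1)) ∞ X] [IsManifold (𝓡 m) ∞ M] in
theorem contMDiff_slice {ε : ℝ} {Φ : ℝ → M → X}
    (hΦ : ContMDiffOn (𝓘(ℝ, ℝ).prod (𝓡 m)) (𝓡∂ (m + 1)) ∞
      (fun z : ℝ × M ↦ Φ z.1 z.2) (Ico 0 ε ×ˢ univ)) {t : ℝ} (ht : t ∈ Ico 0 ε) :
    ContMDiff (𝓡 m) (𝓡∂ (m + 1)) ∞ (Φ t) := by
  rw [← contMDiffOn_univ]
  exact hΦ.comp ((contMDiffOn_const (c := t)).prodMk contMDiffOn_id) (fun q _ ↦ ⟨ht, mem_univ _⟩)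

/-- The differential of the inverse of the preferred boundary chart at `p`. -/
def boundaryFrame (p : M) (y : Eu m) : Eu m →L[ℝ] Eu m :=
  mfderiv 𝓘(ℝ, Eu m) (𝓡 m) (extChartAt (𝓡 m) p).symm y

theorem boundaryFrame_bijective (p : M) {y : Eu m} (hy : y ∈ (extChartAt (𝓡 m) p).target) :
    Function.Bijective (boundaryFrame p y) := by
  have h := (isInvertible_mfderivWithin_extChartAt_symm hy).bijective
  rw [ModelWithCorners.range_eq_univ, mfderivWithin_univ] at h
  exact h

-- The chain rule along the curve $\tau\mapsto(\tau,y)$ and along the slice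
-- $\{t\}\times\mathbb{R}^m$ matches the coordinate differential with `collarDeriv`, in which the
-- collar hypotheses are phrased.
omit [IsManifold (𝓡∂ (m + 1)) ∞ X] in
theorem mfderivWithin_collarChart {ε : ℝ} {Φ : ℝ → M → X} {p : M}
    (hΦ : ContMDiffOn (𝓘(ℝ, ℝ).prod (𝓡 m)) (𝓡∂ (m + 1)) ∞
      (fun z : ℝ × M ↦ Φ z.1 z.2) (Ico 0 ε ×ˢ univ)) {z : ℝ × Eu m} (hz : z ∈ collarDomain ε p)
    (a : ℝ × Eu m) :
    mfderivWithin 𝓘(ℝ, ℝ × Eu m) (𝓡∂ (m + 1)) (collarChart Φ p) (halfSpace (Eu m)) z a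
      = collarDeriv ε Φ z.1 ((extChartAt (𝓡 m) p).symm z.2) a.1 (boundaryFrame p z.2 a.2) := by
  obtain ⟨t, y⟩ := z
  have hd := mdifferentiableWithinAt_collarChart hΦ hz
  set L : ℝ × Eu m →L[ℝ] Eu (m + 1) :=
    mfderivWithin 𝓘(ℝ, ℝ × Eu m) (𝓡∂ (m + 1)) (collarChart Φ p) (halfSpace (Eu m)) (t, y) with hL
  have e1 : collarVelocity ε Φ t ((extChartAt (𝓡 m) p).symm y) = L (1, 0) := by
    have hc : HasFDerivWithinAt (fun τ : ℝ ↦ (τ, y)) (ContinuousLinearMap.inl ℝ ℝ (Eu m))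
        (Ico 0 ε) t := (hasFDerivWithinAt_id t _).prodMk (hasFDerivWithinAt_const y t _)
    have h := mfderivWithin_comp (I' := 𝓘(ℝ, ℝ × Eu m)) (u := halfSpace (Eu m)) t hd
      hc.hasMFDerivWithinAt.mdifferentiableWithinAt (fun τ hτ ↦ ⟨hτ.1, mem_univ _⟩)
      ((uniqueDiffOn_Ico 0 ε) t hz.1).uniqueMDiffWithinAt
    rw [hc.hasMFDerivWithinAt.mfderivWithin
      ((uniqueDiffOn_Ico 0 ε) t hz.1).uniqueMDiffWithinAt] at h
    have h2 := congrArg (fun T : ℝ →L[ℝ] Eu (m + 1) ↦ T 1) h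
    exact h2
  have e2 : ∀ u, mfderiv (𝓡 m) (𝓡∂ (m + 1)) (Φ t) ((extChartAt (𝓡 m) p).symm y)
      (boundaryFrame p y u) = L (0, u) := by
    intro u
    have hc : HasFDerivWithinAt (fun y' : Eu m ↦ (t, y')) (ContinuousLinearMap.inr ℝ ℝ (Eu m))
        univ y := (hasFDerivWithinAt_const t y _).prodMk (hasFDerivWithinAt_id y _)
    have h := mfderivWithin_comp (I' := 𝓘(ℝ, ℝ × Eu m)) (u := halfSpace (Eu m)) y hd
      hc.hasMFDerivWithinAt.mdifferentiableWithinAt (fun τ hτ ↦ ⟨hz.1.1, mem_univ _⟩)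
      uniqueDiffWithinAt_univ.uniqueMDiffWithinAt
    rw [hc.hasMFDerivWithinAt.mfderivWithin uniqueDiffWithinAt_univ.uniqueMDiffWithinAt,
      mfderivWithin_univ] at h
    have hs : MDifferentiableAt 𝓘(ℝ, Eu m) (𝓡 m) (extChartAt (𝓡 m) p).symm y := by
      have := mdifferentiableWithinAt_extChartAt_symm (I := 𝓡 m) hz.2
      rwa [ModelWithCorners.range_eq_univ, mdifferentiableWithinAt_univ] at this
    have h' := mfderiv_comp y ((contMDiff_slice hΦ hz.1).mdifferentiable (by simp) _) hs
    have h2 := congrArg (fun T : Eu m →L[ℝ] Eu (m + 1) ↦ T u) (h'.symm.trans h)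
    exact h2
  have ha : a = a.1 • ((1 : ℝ), (0 : Eu m)) + (0, a.2) := by ext <;> simp
  calc L a = a.1 • L (1, 0) + L (0, a.2) := by conv_lhs => rw [ha, map_add, map_smul]
    _ = _ := by
      rw [← e1, ← e2]
      rfl

end Collar

/-! ### Transfer of Levi-Civita connections to the collar -/

section CollarConnection

open Filter

variable {m : ℕ} {X : Type*} [TopologicalSpace X] [ChartedSpace (EuclideanHalfSpace (m + 1)) X]
  [IsManifold (𝓡∂ (m + 1)) ∞ X] {F : Type*} [NormedAddCommGroup F] [NormedSpace ℝ F]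

theorem contDiffWithinAt_extChartAt_comp {f : F → X} {S : Set F} {z : F}
    (hf : ContMDiffWithinAt 𝓘(ℝ, F) (𝓡∂ (m + 1)) ∞ f S z) (x : X)
    (hx : f z ∈ (extChartAt (𝓡∂ (m + 1)) x).source) :
    ContDiffWithinAt ℝ ∞ (extChartAt (𝓡∂ (m + 1)) x ∘ f) S z := by
  rw [extChartAt_source] at hx
  exact ((contMDiffAt_extChartAt' hx).comp_contMDiffWithinAt z hf).contDiffWithinAt

theorem tendsto_extChartAt_comp {f : F → X} {S : Set F} {z : F}
    (hf : ContMDiffWithinAt 𝓘(ℝ, F) (𝓡∂ (m + 1)) ∞ f S z) (x : X)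
    (hx : f z ∈ (extChartAt (𝓡∂ (m + 1)) x).source) :
    Tendsto (extChartAt (𝓡∂ (m + 1)) x ∘ f) (𝓝[S] z)
      (𝓝[range (𝓡∂ (m + 1))] (extChartAt (𝓡∂ (m + 1)) x (f z))) := by
  refine tendsto_nhdsWithin_iff.2
    ⟨(contDiffWithinAt_extChartAt_comp hf x hx).continuousWithinAt, Eventually.of_forall fun y ↦ ?_⟩
  exact mem_range_self _

/-- A nonzero vector in the kernel would have length zero for the pulled-back metric, which is
positive definite. -/
theorem injective_fderivWithin_extChartAt_comp (g : SmoothMetric (m + 1) X) {f : F → X} {S : Set F}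
    {z : F} (hf : MDifferentiableWithinAt 𝓘(ℝ, F) (𝓡∂ (m + 1)) f S z)
    (hS : UniqueDiffWithinAt ℝ S z)
    (hinj : Function.Injective (mfderivWithin 𝓘(ℝ, F) (𝓡∂ (m + 1)) f S z))
    (x : X) (hx : f z ∈ (extChartAt (𝓡∂ (m + 1)) x).source) :
    Function.Injective (fderivWithin ℝ (extChartAt (𝓡∂ (m + 1)) x ∘ f) S z) := by
  rw [injective_iff_map_eq_zero]
  intro a ha
  by_contra hne
  have h1 := pullbackMetric_pos g f S z hinj a hne
  rw [pullbackMetric_eq_metricInChart g x hf hS hx, ha] at h1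
  simp at h1

/-- Transformation law between the Christoffel symbols of a pulled-back metric and those in a chart
of the manifold. -/
theorem christoffel_law [FiniteDimensional ℝ F] (hF : Module.finrank ℝ F = m + 1)
    (g : SmoothMetric (m + 1) X) {f : F → X} {S t : Set F} {z : F} (hS : UniqueDiffOn ℝ S)
    (ht : UniqueDiffOn ℝ t) (hzc : z ∈ closure (interior S))
    (hf : ContMDiffOn 𝓘(ℝ, F) (𝓡∂ (m + 1)) ∞ f t) (hts : t ⊆ S) (hz : z ∈ t)
    (hst : ∀ z ∈ t, t ∈ 𝓝[S] z)
    (hinj : Function.Injective (mfderivWithin 𝓘(ℝ, F) (𝓡∂ (m + 1)) f S z))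
    (x : X) (hx : f z ∈ (extChartAt (𝓡∂ (m + 1)) x).source) (a b : F) :
    fderivWithin ℝ (extChartAt (𝓡∂ (m + 1)) x ∘ f) S z
        (christoffelOf (pullbackMetric g f S) S z a b)
      = christoffel g x (extChartAt (𝓡∂ (m + 1)) x (f z))
          (fderivWithin ℝ (extChartAt (𝓡∂ (m + 1)) x ∘ f) S z a)
          (fderivWithin ℝ (extChartAt (𝓡∂ (m + 1)) x ∘ f) S z b)
        + fderivWithin ℝ (fderivWithin ℝ (extChartAt (𝓡∂ (m + 1)) x ∘ f) S) S z a b := by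
  have hfz : ContMDiffWithinAt 𝓘(ℝ, F) (𝓡∂ (m + 1)) ∞ f S z :=
    (hf z hz).mono_of_mem_nhdsWithin (hst z hz)
  have hpull : ∀ᶠ y in 𝓝[S] z, ∀ a b, pullbackMetric g f S y a b
      = metricInChart g x ((extChartAt (𝓡∂ (m + 1)) x ∘ f) y)
        (fderivWithin ℝ (extChartAt (𝓡∂ (m + 1)) x ∘ f) S y a)
        (fderivWithin ℝ (extChartAt (𝓡∂ (m + 1)) x ∘ f) S y b) := by
    filter_upwards [hst z hz, hfz.continuousWithinAt.preimage_mem_nhdsWithin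
      ((isOpen_extChartAt_source x).mem_nhds hx)] with y hy hyx a b
    exact pullbackMetric_eq_metricInChart g x
      (((hf y hy).mdifferentiableWithinAt (by simp)).mono_of_mem_nhdsWithin (hst y hy))
      (hS y (hts hy)) hyx a b
  have hpos := pullbackMetric_pos g f S z hinj
  have htgt := (extChartAt (𝓡∂ (m + 1)) x).map_source hx
  refine christoffelOf_pullback hS (hts hz) hzc (contDiffWithinAt_extChartAt_comp hfz x hx)
    (tendsto_extChartAt_comp hfz x hx)
    ((contDiffWithinAt_metricInChart g x htgt).differentiableWithinAt (by simp))
    ((contDiffWithinAt_pullbackMetric g hf hS ht hts hz hst).differentiableWithinAt (by simp))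
    ((𝓡∂ (m + 1)).uniqueDiffOn _ (mem_range_self _)) (pullbackMetric_symm g _ _) hpull
    (isInvertible_metricInChart g x htgt) (isInvertible_of_pos _ hpos) ?_ a b
  have hDinj := injective_fderivWithin_extChartAt_comp g (hfz.mdifferentiableWithinAt (by simp))
    (hS z (hts hz)) hinj x hx
  exact (LinearMap.injective_iff_surjective_of_finrank_eq_finrank
    (f := (fderivWithin ℝ (extChartAt (𝓡∂ (m + 1)) x ∘ f) S z).toLinearMap)
    (by rw [hF]; simp)).1 hDinj

end CollarConnection

/-! ### The collar metrics form a product pair -/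

section CollarPair

open Filter

variable {m : ℕ} {X : Type*} [TopologicalSpace X] [ChartedSpace (EuclideanHalfSpace (m + 1)) X]
  {M : Type*} [TopologicalSpace M] [ChartedSpace (EuclideanSpace ℝ (Fin m)) M]
  [IsManifold (𝓡∂ (m + 1)) ∞ X] [IsManifold (𝓡 m) ∞ M] {ι : M → X}
  {g g₀ : SmoothMetric (m + 1) X} {ε : ℝ} {Φ : ℝ → M → X} {p : M}

theorem injective_mfderivWithin_collarChart (hΦ : IsNormalCollar g ι ε Φ) {z : ℝ × Eu m}
    (hz : z ∈ collarDomain ε p) :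
    Function.Injective
      (mfderivWithin 𝓘(ℝ, ℝ × Eu m) (𝓡∂ (m + 1)) (collarChart Φ p) (halfSpace (Eu m)) z) := by
  refine (injective_iff_map_eq_zero _).2 fun a ha ↦ ?_
  obtain ⟨h1, h2⟩ := hΦ.immersive z.1 hz.1 _ _ _
    ((mfderivWithin_collarChart hΦ.smooth hz a).symm.trans ha)
  refine Prod.ext h1 ?_
  exact (boundaryFrame_bijective p hz.2).injective (h2.trans (map_zero (boundaryFrame p z.2)).symm)

omit [IsManifold (𝓡 m) ∞ M] in
theorem mem_collarDomain_boundary (hΦ : IsNormalCollar g ι ε Φ) {y : Eu m}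
    (hy : y ∈ (extChartAt (𝓡 m) p).target) : ((0 : ℝ), y) ∈ collarDomain ε p :=
  ⟨⟨le_rfl, hΦ.pos⟩, hy⟩

theorem collar_christoffel_law (hΦ : IsNormalCollar g ι ε Φ) (g' : SmoothMetric (m + 1) X)
    {z : ℝ × Eu m} (hz : z ∈ collarDomain ε p) (x : X)
    (hx : collarChart Φ p z ∈ (extChartAt (𝓡∂ (m + 1)) x).source) (a b : ℝ × Eu m) :
    fderivWithin ℝ (extChartAt (𝓡∂ (m + 1)) x ∘ collarChart Φ p) (halfSpace (Eu m)) z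
        (christoffelOf (pullbackMetric g' (collarChart Φ p) (halfSpace (Eu m)))
          (halfSpace (Eu m)) z a b)
      = christoffel g' x (extChartAt (𝓡∂ (m + 1)) x (collarChart Φ p z))
          (fderivWithin ℝ (extChartAt (𝓡∂ (m + 1)) x ∘ collarChart Φ p) (halfSpace (Eu m)) z a)
          (fderivWithin ℝ (extChartAt (𝓡∂ (m + 1)) x ∘ collarChart Φ p) (halfSpace (Eu m)) z b)
        + fderivWithin ℝ (fderivWithin ℝ (extChartAt (𝓡∂ (m + 1)) x ∘ collarChart Φ p)
          (halfSpace (Eu m))) (halfSpace (Eu m)) z a b :=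
  christoffel_law (by simp [add_comm]) g' uniqueDiffOn_halfSpace (uniqueDiffOn_collarDomain ε p)
    (mem_closure_interior_halfSpace (collarDomain_subset ε p hz))
    (contMDiffOn_collarChart p hΦ.smooth) (collarDomain_subset ε p) hz
    (fun _ h ↦ collarDomain_mem_nhdsWithin h) (injective_mfderivWithin_collarChart hΦ hz) x hx a b

theorem contDiffWithinAt_collarMetric (hΦ : IsNormalCollar g ι ε Φ) (g' : SmoothMetric (m + 1) X)
    {z : ℝ × Eu m} (hz : z ∈ collarDomain ε p) :
    ContDiffWithinAt ℝ ∞ (pullbackMetric g' (collarChart Φ p) (halfSpace (Eu m)))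
      (halfSpace (Eu m)) z :=
  contDiffWithinAt_pullbackMetric g' (contMDiffOn_collarChart p hΦ.smooth) uniqueDiffOn_halfSpace
    (uniqueDiffOn_collarDomain ε p) (collarDomain_subset ε p) hz
    (fun _ h ↦ collarDomain_mem_nhdsWithin h)

theorem collarMetric_apply (hΦ : IsNormalCollar g ι ε Φ) (g' : SmoothMetric (m + 1) X)
    {z : ℝ × Eu m} (hz : z ∈ collarDomain ε p) (a b : ℝ × Eu m) :
    pullbackMetric g' (collarChart Φ p) (halfSpace (Eu m)) z a b
      = g'.inner (Φ z.1 ((extChartAt (𝓡 m) p).symm z.2))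
        (collarDeriv ε Φ z.1 ((extChartAt (𝓡 m) p).symm z.2) a.1 (boundaryFrame p z.2 a.2))
        (collarDeriv ε Φ z.1 ((extChartAt (𝓡 m) p).symm z.2) b.1 (boundaryFrame p z.2 b.2)) := by
  rw [← mfderivWithin_collarChart hΦ.smooth hz, ← mfderivWithin_collarChart hΦ.smooth hz]
  rfl

theorem bilinear_expand {V : Type*} [AddCommGroup V] [Module ℝ V] [TopologicalSpace V]
    [IsTopologicalAddGroup V] [ContinuousSMul ℝ V] (B : V →L[ℝ] V →L[ℝ] ℝ)
    (ν u v : V) (a b : ℝ) (h₁ : B ν ν = 1) (h₂ : B ν v = 0) (h₃ : B u ν = 0) :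
    B (a • ν + u) (b • ν + v) = a * b + B u v := by
  simp only [map_add, map_smul, add_apply, smul_apply, smul_eq_mul, h₁, h₂, h₃]
  ring

omit [IsManifold (𝓡 m) ∞ M] in
theorem inducedMetric_zero (q : M) (u : TangentSpace (𝓡 m) q) : inducedMetric g ι q u 0 = 0 := by
  unfold inducedMetric
  rw [map_zero]
  exact map_zero _

/-- At $t=0$ the velocity of the collar is the unit normal, so the mixed terms vanish and `g`
already has the shape $dt^2+h$. -/
theorem collarMetric_boundary (hΦ : IsNormalCollar g ι ε Φ) {y : Eu m}
    (hy : y ∈ (extChartAt (𝓡 m) p).target) (a b : ℝ × Eu m) :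
    pullbackMetric g (collarChart Φ p) (halfSpace (Eu m)) (0, y) a b
      = a.1 * b.1 + inducedMetric g ι ((extChartAt (𝓡 m) p).symm y) (boundaryFrame p y a.2)
        (boundaryFrame p y b.2) := by
  obtain rfl : ι = Φ 0 := funext fun q ↦ (hΦ.initial_point q).symm
  rw [collarMetric_apply hΦ g (mem_collarDomain_boundary hΦ hy)]
  have hν := hΦ.initial_velocity ((extChartAt (𝓡 m) p).symm y)
  exact bilinear_expand (g.inner (Φ 0 ((extChartAt (𝓡 m) p).symm y))) _ _ _ _ _ hν.unit
    (hν.normal (boundaryFrame p y b.2)) ((g.symm _ _ _).trans (hν.normal (boundaryFrame p y a.2)))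

/-- The curve $c(\tau)=\varphi(\tau,y)$ has $c'=D\varphi(\partial_t)$ and
$c''=D^2\varphi(\partial_t,\partial_t)$, so the transformation law identifies
$D\varphi(\Gamma(\partial_t,\partial_t))$ with the left side of the geodesic equation. -/
theorem collarMetric_geodesic (hΦ : IsNormalCollar g ι ε Φ) {y : Eu m}
    (hy : y ∈ (extChartAt (𝓡 m) p).target) :
    christoffelOf (pullbackMetric g (collarChart Φ p) (halfSpace (Eu m))) (halfSpace (Eu m))
      (0, y) (1, 0) (1, 0) = 0 := by
  have hz := mem_collarDomain_boundary hΦ hy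
  set q := (extChartAt (𝓡 m) p).symm y with hq
  set x := Φ 0 q with hxdef
  have hx : collarChart Φ p (0, y) ∈ (extChartAt (𝓡∂ (m + 1)) x).source :=
    mem_extChartAt_source x
  set φ := extChartAt (𝓡∂ (m + 1)) x ∘ collarChart (m := m) Φ p with hφ
  have hsm := contMDiffOn_collarChart (m := m) p hΦ.smooth
  have hsmS : ∀ z ∈ collarDomain (m := m) ε p,
      ContMDiffWithinAt 𝓘(ℝ, ℝ × Eu m) (𝓡∂ (m + 1)) ∞ (collarChart Φ p) (halfSpace (Eu m)) z :=
    fun z hz ↦ (hsm z hz).mono_of_mem_nhdsWithin (collarDomain_mem_nhdsWithin hz)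
  have hφs : ContDiffWithinAt ℝ ∞ φ (halfSpace (Eu m)) (0, y) :=
    contDiffWithinAt_extChartAt_comp (hsmS (0, y) hz) x hx
  have ud : UniqueDiffOn ℝ (Ico (0 : ℝ) ε) := uniqueDiffOn_Ico 0 ε
  have h0 : (0 : ℝ) ∈ Ico 0 ε := ⟨le_rfl, hΦ.pos⟩
  have slice : ∀ {Z : Type} [NormedAddCommGroup Z] [NormedSpace ℝ Z] (G : ℝ × Eu m → Z), ∀ t ∈ Ico 0 ε,
      DifferentiableWithinAt ℝ G (halfSpace (Eu m)) (t, y) →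
      derivWithin (fun τ ↦ G (τ, y)) (Ico 0 ε) t
        = fderivWithin ℝ G (halfSpace (Eu m)) (t, y) (1, 0) := by
    intro Z _ _ G t ht hG
    have hc : HasFDerivWithinAt (fun τ : ℝ ↦ (τ, y)) (ContinuousLinearMap.inl ℝ ℝ (Eu m))
        (Ico 0 ε) t := (hasFDerivWithinAt_id t _).prodMk (hasFDerivWithinAt_const y t _)
    have h := HasFDerivWithinAt.comp (t := halfSpace (Eu m)) t hG.hasFDerivWithinAt hc
      (fun τ hτ ↦ ⟨hτ.1, mem_univ _⟩)
    have h' := h.hasDerivWithinAt.derivWithin (ud t ht)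
    simp only [Function.comp_def] at h'
    rw [h']
    simp
  have hgeo := (hΦ.geodesic q).2 0 h0
  have hc : (fun τ ↦ extChartAt (𝓡∂ (m + 1)) (Φ 0 q) (Φ τ q)) = fun τ ↦ φ (τ, y) := rfl
  have hd1 : derivWithin (fun τ ↦ φ (τ, y)) (Ico 0 ε) 0
      = fderivWithin ℝ φ (halfSpace (Eu m)) (0, y) (1, 0) :=
    slice φ 0 h0 (hφs.differentiableWithinAt (by simp))
  -- The velocity must be identified for all small times, since it is differentiated once more.
  have hev : derivWithin (fun τ ↦ φ (τ, y)) (Ico 0 ε) =ᶠ[𝓝[Ico 0 ε] (0 : ℝ)]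
      fun τ ↦ fderivWithin ℝ φ (halfSpace (Eu m)) (τ, y) (1, 0) := by
    have hcont : Tendsto (fun τ : ℝ ↦ (τ, y)) (𝓝[Ico 0 ε] 0) (𝓝[halfSpace (Eu m)] (0, y)) :=
      tendsto_nhdsWithin_iff.2 ⟨((Continuous.prodMk_left y).tendsto 0).mono_left nhdsWithin_le_nhds,
        by filter_upwards [self_mem_nhdsWithin] with τ hτ using ⟨hτ.1, mem_univ _⟩⟩
    have hsrc := hcont.eventually ((hsmS (0, y) hz).continuousWithinAt.preimage_mem_nhdsWithin
      ((isOpen_extChartAt_source x).mem_nhds hx))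
    filter_upwards [hsrc, self_mem_nhdsWithin] with τ hτ hτ'
    exact slice φ τ hτ' ((contDiffWithinAt_extChartAt_comp (hsmS (τ, y) ⟨hτ', hy⟩) x
      hτ).differentiableWithinAt (by simp))
  have hDφ : DifferentiableWithinAt ℝ (fderivWithin ℝ φ (halfSpace (Eu m))) (halfSpace (Eu m))
      (0, y) := (hφs.fderivWithin_right (m := ∞) uniqueDiffOn_halfSpace (by simp)
        (collarDomain_subset ε p hz)).differentiableWithinAt (by simp)
  have hd2 : iteratedDerivWithin 2 (fun τ ↦ φ (τ, y)) (Ico 0 ε) 0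
      = fderivWithin ℝ (fderivWithin ℝ φ (halfSpace (Eu m))) (halfSpace (Eu m)) (0, y)
        (1, 0) (1, 0) := by
    rw [iteratedDerivWithin_succ, iteratedDerivWithin_one, hev.derivWithin_eq hd1,
      slice (fun z ↦ fderivWithin ℝ φ (halfSpace (Eu m)) z (1, 0)) 0 h0
        (hDφ.clm_apply (differentiableWithinAt_const _)),
      fderivWithin_clm_apply (IsProductPair.uniqueDiff y) hDφ (differentiableWithinAt_const _)]
    simp
  simp only [hc, hd1, hd2] at hgeo
  have law := collar_christoffel_law hΦ g hz x hx (1, 0) (1, 0)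
  have inj := injective_fderivWithin_extChartAt_comp g
    ((hsmS (0, y) hz).mdifferentiableWithinAt (by simp)) (IsProductPair.uniqueDiff y)
    (injective_mfderivWithin_collarChart hΦ hz) x hx
  apply inj
  rw [law, map_zero]
  exact (add_comm _ _).trans hgeo

theorem isProductPair_collarMetric (hΦ : IsNormalCollar g ι ε Φ)
    (hg₀ : EqProductNearBoundary g₀ g ι ε Φ) {y : Eu m} (hy : y ∈ (extChartAt (𝓡 m) p).target) :
    IsProductPair (pullbackMetric g₀ (collarChart Φ p) (halfSpace (Eu m)))
      (pullbackMetric g (collarChart Φ p) (halfSpace (Eu m))) y := by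
  obtain ⟨δ, hδ, hδε, hprod⟩ := hg₀
  have hz := mem_collarDomain_boundary hΦ hy
  have prod : ∀ t ∈ Ico 0 δ, ∀ y ∈ (extChartAt (𝓡 m) p).target, ∀ a b,
      pullbackMetric g₀ (collarChart Φ p) (halfSpace (Eu m)) (t, y) a b
        = a.1 * b.1 + inducedMetric g ι ((extChartAt (𝓡 m) p).symm y) (boundaryFrame p y a.2)
          (boundaryFrame p y b.2) := by
    intro t ht y hy a b
    rw [collarMetric_apply hΦ g₀ ⟨⟨ht.1, ht.2.trans_le hδε⟩, hy⟩]
    exact hprod t ht _ _ _ _ _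
  have h0 : (0 : ℝ) ∈ Ico 0 δ := ⟨le_rfl, hδ⟩
  refine ⟨(contDiffWithinAt_collarMetric hΦ g₀ hz).differentiableWithinAt (by simp),
    (contDiffWithinAt_collarMetric hΦ g hz).differentiableWithinAt (by simp),
    pullbackMetric_symm g₀ _ _, pullbackMetric_symm g _ _,
    isInvertible_of_pos _ (pullbackMetric_pos g₀ _ _ _ (injective_mfderivWithin_collarChart hΦ hz)),
    ?_, ?_, ?_, collarMetric_geodesic hΦ hy⟩
  · filter_upwards [(isOpen_boundaryTarget p).mem_nhds hy] with y' hy'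
    refine ContinuousLinearMap.ext fun a ↦ ContinuousLinearMap.ext fun b ↦ ?_
    rw [prod 0 h0 y' hy', collarMetric_boundary hΦ hy']
  -- The domain is cut down to times below `δ`, where the product form of `g₀` is available.
  · filter_upwards [collarDomain_mem_nhdsWithin
      (show ((0 : ℝ), y) ∈ collarDomain (m := m) δ p from ⟨h0, hy⟩)]
      with z hz a
    rw [show z = (z.1, z.2) from rfl, prod _ hz.1 _ hz.2, show boundaryFrame p z.2 ((1 : ℝ), (0 : Eu m)).2 = 0 from
      map_zero (boundaryFrame p z.2)]
    erw [inducedMetric_zero]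
    simp
  · filter_upwards [Ico_mem_nhdsGE hδ] with t ht
    refine ContinuousLinearMap.ext fun a ↦ ContinuousLinearMap.ext fun b ↦ ?_
    rw [prod t ht y hy, prod 0 h0 y hy]

end CollarPair

/-! ### Linear versions of the tensors at a point -/

section PointwiseTensors

variable {n : ℕ} [NeZero n] {X : Type*} [TopologicalSpace X]
  [ChartedSpace (EuclideanHalfSpace n) X] [IsManifold (𝓡∂ n) ∞ X]

/-- `theta` as a linear map. -/
def thetaLinear (g₀ g : SmoothMetric n X) (x : X) : Eu n →ₗ[ℝ] Module.End ℝ (Eu n) :=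
  ContinuousLinearMap.coeLM ℝ ∘ₗ
    (christoffel g x (extChartAt (𝓡∂ n) x x) - christoffel g₀ x (extChartAt (𝓡∂ n) x x)).toLinearMap

/-- `segmentCurvature` as a bilinear map. -/
def segmentCurvatureLinear (g₀ g : SmoothMetric n X) (s : ℝ) (x : X) :
    Eu n →ₗ[ℝ] Eu n →ₗ[ℝ] Module.End ℝ (Eu n) :=
  LinearMap.mk₂ ℝ (fun u v ↦ (curvatureOf (segmentSymbols g₀ g s x) (range (𝓡∂ n))
      (extChartAt (𝓡∂ n) x x) u v).toLinearMap)
    (by intros; ext1; simp) (by intros; ext1; simp) (by intros; ext1; simp) (by intros; ext1; simp)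

theorem segmentCurvatureLinear_neg_swap (g₀ g : SmoothMetric n X) (s : ℝ) (x : X) (u v : Eu n) :
    segmentCurvatureLinear g₀ g s x u v = - segmentCurvatureLinear g₀ g s x v u :=
  LinearMap.ext fun w ↦ congrArg (fun T : Eu n →L[ℝ] Eu n ↦ T w) (curvatureOf_neg_swap _ _ _ u v)

/-- The Ricci tensor as a bilinear map. -/
def ricciLinear (g : SmoothMetric n X) (x : X) : Eu n →ₗ[ℝ] Eu n →ₗ[ℝ] ℝ :=
  LinearMap.mk₂ ℝ (ricci g x)
    (by intros; simp [ricci]) (by intros; simp [ricci])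
    (by intros; simp [ricci]) (by intros; simp [ricci])

/-- The Schouten tensor as a bilinear map. -/
def schoutenLinear (g : SmoothMetric n X) (x : X) : Eu n →ₗ[ℝ] Eu n →ₗ[ℝ] ℝ :=
  (1 / ((n : ℝ) - 2)) • (ricciLinear g x - (scalarCurvature g x / (2 * ((n : ℝ) - 1))) •
    ContinuousLinearMap.coeLM ℝ ∘ₗ
      (show Eu n →L[ℝ] Eu n →L[ℝ] ℝ from g.inner x).toLinearMap)

end PointwiseTensors

/-! ### Curvature of the segment of connections in the collar -/

section Boundary

open Filter

variable {m : ℕ} {X : Type*} [TopologicalSpace X] [ChartedSpace (EuclideanHalfSpace (m + 1)) X]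
  {M : Type*} [TopologicalSpace M] [ChartedSpace (EuclideanSpace ℝ (Fin m)) M]
  [IsManifold (𝓡∂ (m + 1)) ∞ X] [IsManifold (𝓡 m) ∞ M] {ι : M → X}
  {g g₀ : SmoothMetric (m + 1) X} {ε : ℝ} {Φ : ℝ → M → X} {p : M}

/-- The connection `∇⁰ + s θ` in collar coordinates. -/
def collarSegment (g₀ g : SmoothMetric (m + 1) X) (s : ℝ) (Φ : ℝ → M → X) (p : M) (z : ℝ × Eu m) :
    ℝ × Eu m →L[ℝ] ℝ × Eu m →L[ℝ] ℝ × Eu m :=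
  christoffelOf (pullbackMetric g₀ (collarChart Φ p) (halfSpace (Eu m))) (halfSpace (Eu m)) z
    + s • (christoffelOf (pullbackMetric g (collarChart Φ p) (halfSpace (Eu m))) (halfSpace (Eu m)) z
      - christoffelOf (pullbackMetric g₀ (collarChart Φ p) (halfSpace (Eu m))) (halfSpace (Eu m)) z)

theorem contMDiffWithinAt_collarChart (hΦ : IsNormalCollar g ι ε Φ) {z : ℝ × Eu m}
    (hz : z ∈ collarDomain ε p) :
    ContMDiffWithinAt 𝓘(ℝ, ℝ × Eu m) (𝓡∂ (m + 1)) ∞ (collarChart Φ p) (halfSpace (Eu m)) z :=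
  (contMDiffOn_collarChart p hΦ.smooth z hz).mono_of_mem_nhdsWithin (collarDomain_mem_nhdsWithin hz)

theorem differentiableWithinAt_collarChristoffel (hΦ : IsNormalCollar g ι ε Φ)
    (g' : SmoothMetric (m + 1) X) {z : ℝ × Eu m} (hz : z ∈ collarDomain ε p) :
    DifferentiableWithinAt ℝ
      (christoffelOf (pullbackMetric g' (collarChart Φ p) (halfSpace (Eu m))) (halfSpace (Eu m)))
      (halfSpace (Eu m)) z :=
  (contDiffWithinAt_christoffelOf (contDiffWithinAt_collarMetric hΦ g' hz)
    (isInvertible_of_pos _ (pullbackMetric_pos g' _ _ _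
      (injective_mfderivWithin_collarChart hΦ hz))) uniqueDiffOn_halfSpace
    (collarDomain_subset ε p hz)).differentiableWithinAt (by simp)

omit [IsManifold (𝓡 m) ∞ M] [ChartedSpace (EuclideanSpace ℝ (Fin m)) M] [TopologicalSpace M] in
theorem differentiableWithinAt_christoffel (g' : SmoothMetric (m + 1) X) (x : X) {e : Eu (m + 1)}
    (he : e ∈ (extChartAt (𝓡∂ (m + 1)) x).target) :
    DifferentiableWithinAt ℝ (christoffel g' x) (range (𝓡∂ (m + 1))) e :=
  (contDiffWithinAt_christoffelOf (contDiffWithinAt_metricInChart g' x he)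
    (isInvertible_metricInChart g' x he) (𝓡∂ (m + 1)).uniqueDiffOn
    (extChartAt_target_subset_range x he)).differentiableWithinAt (by simp)

/-- The curvature of `∇⁰ + s θ` in collar coordinates. -/
theorem collar_curvature_law (hΦ : IsNormalCollar g ι ε Φ) (g₀ g₁ : SmoothMetric (m + 1) X) (s : ℝ)
    {z : ℝ × Eu m} (hz : z ∈ collarDomain ε p) (x : X)
    (hx : collarChart Φ p z ∈ (extChartAt (𝓡∂ (m + 1)) x).source) (a b c : ℝ × Eu m) :
    fderivWithin ℝ (extChartAt (𝓡∂ (m + 1)) x ∘ collarChart Φ p) (halfSpace (Eu m)) z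
        (curvatureOf (collarSegment g₀ g₁ s Φ p) (halfSpace (Eu m)) z a b c)
      = curvatureOf (segmentSymbols g₀ g₁ s x) (range (𝓡∂ (m + 1)))
          (extChartAt (𝓡∂ (m + 1)) x (collarChart Φ p z))
          (fderivWithin ℝ (extChartAt (𝓡∂ (m + 1)) x ∘ collarChart Φ p) (halfSpace (Eu m)) z a)
          (fderivWithin ℝ (extChartAt (𝓡∂ (m + 1)) x ∘ collarChart Φ p) (halfSpace (Eu m)) z b)
          (fderivWithin ℝ (extChartAt (𝓡∂ (m + 1)) x ∘ collarChart Φ p) (halfSpace (Eu m)) z c) := by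
  have hfz := contMDiffWithinAt_collarChart hΦ hz
  have htgt := (extChartAt (𝓡∂ (m + 1)) x).map_source hx
  have hd : ∀ g', DifferentiableWithinAt ℝ (christoffel g' x) (range (𝓡∂ (m + 1)))
      (extChartAt (𝓡∂ (m + 1)) x (collarChart Φ p z)) := fun g' ↦
    differentiableWithinAt_christoffel g' x htgt
  have hd' := fun g' ↦ differentiableWithinAt_collarChristoffel hΦ g' hz
  refine curvatureOf_pullback uniqueDiffOn_halfSpace (collarDomain_subset ε p hz)
    (mem_closure_interior_halfSpace (collarDomain_subset ε p hz))
    (contDiffWithinAt_extChartAt_comp hfz x hx) (tendsto_extChartAt_comp hfz x hx)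
    ((hd g₀).add (((hd g₁).sub (hd g₀)).const_smul s))
    ((hd' g₀).add (((hd' g₁).sub (hd' g₀)).const_smul s)) ?_ a b c
  -- The symbols of $\nabla^0+s\theta$ are an affine combination with weights $1-s$ and $s$, so the
  -- term $D^2\varphi$ occurs exactly once, as the transformation law requires.
  filter_upwards [collarDomain_mem_nhdsWithin hz, hfz.continuousWithinAt.preimage_mem_nhdsWithin
    ((isOpen_extChartAt_source x).mem_nhds hx)] with y hy hyx a b
  have h₀ := collar_christoffel_law hΦ g₀ hy x hyx a b
  have h₁ := collar_christoffel_law hΦ g₁ hy x hyx a b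
  simp only [Pi.add_apply, Pi.smul_apply, Pi.sub_apply, add_apply, smul_apply, sub_apply, map_add,
    map_smul, map_sub, Function.comp_apply]
  rw [h₀, h₁, add_sub_add_right_eq_sub]
  abel

/-- At the centre of the preferred charts, the manifold derivative is by definition the derivative
of the chart expression, here that of the collar restricted to $t=0$. -/
theorem mfderiv_boundary (hΦ : IsNormalCollar g ι ε Φ) (p : M) (u : Eu m) :
    mfderiv (𝓡 m) (𝓡∂ (m + 1)) (Φ 0) p u
      = fderivWithin ℝ (extChartAt (𝓡∂ (m + 1)) (Φ 0 p) ∘ collarChart Φ p) (halfSpace (Eu m))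
        (0, extChartAt (𝓡 m) p p) (0, u) := by
  have hz := mem_collarDomain_boundary hΦ (mem_extChartAt_target (I := 𝓡 m) p)
  have hx : collarChart Φ p (0, extChartAt (𝓡 m) p p) ∈ (extChartAt (𝓡∂ (m + 1)) (Φ 0 p)).source := by
    rw [show collarChart Φ p (0, extChartAt (𝓡 m) p p) = Φ 0 p from
      congrArg (Φ 0) (extChartAt_to_inv p)]
    exact mem_extChartAt_source _
  rw [fderivWithin_halfSpace_tangential ((contDiffWithinAt_extChartAt_comp
    (contMDiffWithinAt_collarChart hΦ hz) _ hx).differentiableWithinAt (by simp)),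
    ((contMDiff_slice hΦ.smooth ⟨le_rfl, hΦ.pos⟩).mdifferentiable (by simp) p).mfderiv,
    ModelWithCorners.range_eq_univ, fderivWithin_univ]
  rfl

end Boundary

end Transgression

end

/-! ### The theorem -/

open Transgression in
theorem proposition4 {m k : ℕ} (hm : m + 1 = 4 * k)
    {X : Type*} [TopologicalSpace X] [T2Space X] [CompactSpace X]
    [ChartedSpace (EuclideanHalfSpace (m + 1)) X] [IsManifold (𝓡∂ (m + 1)) ∞ X]
    {M : Type*} [TopologicalSpace M] [ChartedSpace (EuclideanSpace ℝ (Fin m)) M]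
    [IsManifold (𝓡 m) ∞ M]
    (ι : M → X) (hι : IsBoundaryInclusion (m := m) ι)
    (g g₀ : SmoothMetric (m + 1) X)
    (ε : ℝ) (Φ : ℝ → M → X) (hΦ : IsNormalCollar g ι ε Φ)
    (hg₀ : EqProductNearBoundary g₀ g ι ε Φ)
    (p : M) (hW : ∀ u₁ u₂ u₃ u₄ : TangentSpace (𝓡∂ (m + 1)) (ι p), weyl g (ι p) u₁ u₂ u₃ u₄ = 0)
    (Q : Polynomial ℝ) (s : ℝ) :
    pullbackForms (mfderiv (𝓡 m) (𝓡∂ (m + 1)) ι p : TangentSpace (𝓡 m) p →ₗ[ℝ] _)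
      (transgressionForm g₀ g Q s (ι p)) = 0 := by
  obtain rfl : ι = Φ 0 := funext fun q ↦ (hΦ.initial_point q).symm
  set x : X := Φ 0 p
  set y : Eu m := extChartAt (𝓡 m) p p
  have hyt : y ∈ (extChartAt (𝓡 m) p).target := mem_extChartAt_target p
  have hz : ((0 : ℝ), y) ∈ collarDomain ε p := mem_collarDomain_boundary hΦ hyt
  have hfx : collarChart Φ p (0, y) = x := congrArg (Φ 0) (extChartAt_to_inv p)
  have hx : collarChart Φ p (0, y) ∈ (extChartAt (𝓡∂ (m + 1)) x).source := by
    rw [hfx]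
    exact mem_extChartAt_source x
  have hfz := contMDiffWithinAt_collarChart hΦ hz
  have hinj := injective_mfderivWithin_collarChart hΦ hz
  set φ := extChartAt (𝓡∂ (m + 1)) x ∘ collarChart (m := m) Φ p
  set D' := fderivWithin ℝ φ (halfSpace (Eu m)) (0, y)
  have hDinj : Function.Injective D' := injective_fderivWithin_extChartAt_comp g
    (hfz.mdifferentiableWithinAt (by simp)) (IsProductPair.uniqueDiff y) hinj x hx
  -- The differential of the collar is an isomorphism $\mathbb{R}\times T_pM\to T_xX$ by dimension;
  -- it realises the splitting into normal and tangential parts.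
  let D₀ : (ℝ × Eu m) ≃ₗ[ℝ] Eu (m + 1) :=
    LinearEquiv.ofInjectiveOfFinrankEq D'.toLinearMap hDinj (by simp [add_comm])
  let D : (ℝ × Eu m) ≃ₗ[ℝ] TangentSpace (𝓡∂ (m + 1)) x := D₀
  have hD : ∀ a, D a = D' a := fun _ ↦ rfl
  have hf : ∀ u : Eu m, mfderiv (𝓡 m) (𝓡∂ (m + 1)) (Φ 0) p u = D (0, u) := mfderiv_boundary hΦ p
  have hmetric : ∀ a b, pullbackMetric g (collarChart Φ p) (halfSpace (Eu m)) (0, y) a b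
      = g.inner x (D a) (D b) := by
    intro a b
    rw [pullbackMetric_eq_metricInChart g x (hfz.mdifferentiableWithinAt (by simp))
      (IsProductPair.uniqueDiff y) hx, hfx]
    exact metricInChart_self g x _ _
  let T : TangentSpace (𝓡∂ (m + 1)) x →ₗ[ℝ] Module.End ℝ (TangentSpace (𝓡∂ (m + 1)) x) :=
    thetaLinear g₀ g x
  let R : TangentSpace (𝓡∂ (m + 1)) x →ₗ[ℝ] TangentSpace (𝓡∂ (m + 1)) x →ₗ[ℝ]
      Module.End ℝ (TangentSpace (𝓡∂ (m + 1)) x) := segmentCurvatureLinear g₀ g s x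
  let L : Eu m →ₗ[ℝ] TangentSpace (𝓡∂ (m + 1)) x :=
    (mfderiv (𝓡 m) (𝓡∂ (m + 1)) (Φ 0) p).toLinearMap
  have key : pullbackForms L (trForm (oneForm (coordBasis (m + 1) x) T *
      Polynomial.aeval (twoForm (coordBasis (m + 1) x) fun u v ↦ R u v) Q)) = 0 := by
    refine pullbackForms_trForm_eq_zero_of_isProductPair (coordBasis (m + 1) x)
      (EuclideanSpace.basisFun (Fin m) ℝ).toBasis D L hf T R ?_
      (y := y) ?_ (contDiffWithinAt_collarMetric hΦ g₀ hz) (contDiffWithinAt_collarMetric hΦ g hz)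
      (pullbackMetric_pos g _ _ _ hinj) s ?_ ?_
      ((schoutenLinear g x).compl₁₂ D₀.toLinearMap D₀.toLinearMap) ?_ Q
    · intro u v
      exact segmentCurvatureLinear_neg_swap g₀ g s x u v
    · filter_upwards [(isOpen_boundaryTarget p).mem_nhds hyt] with y' hy'
      exact isProductPair_collarMetric hΦ hg₀ hy'
    · intro a a'
      have h₀ := collar_christoffel_law hΦ g₀ hz x hx a a'
      have h₁ := collar_christoffel_law hΦ g hz x hx a a'
      rw [hfx] at h₀ h₁
      -- Subtracting the two transformation laws removes $D^2\varphi$, so `θ` transforms as a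
      -- tensor.
      have h := congrArg₂ (· - ·) h₁ h₀
      rw [add_sub_add_right_eq_sub] at h
      exact ((map_sub D' _ _).trans h).symm
    · intro a a' a''
      have h := collar_curvature_law hΦ g₀ g s hz x hx a a' a''
      rw [hfx] at h
      exact h.symm
    · intro u₁ u₂ u₃ u₄
      -- At $s=1$ the segment ends at the Levi-Civita connection of `g`, whose curvature enters the
      -- Weyl tensor.
      have h := collar_curvature_law hΦ g₀ g 1 hz x hx u₁ u₂ u₃
      rw [hfx] at h
      have e₁ : collarSegment g₀ g 1 Φ p = christoffelOf
          (pullbackMetric g (collarChart Φ p) (halfSpace (Eu m))) (halfSpace (Eu m)) := by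
        funext z
        simp [collarSegment]
      have e₂ : segmentSymbols g₀ g 1 x = christoffel g x := by
        funext z
        simp [segmentSymbols]
      rw [e₁, e₂] at h
      have hw := hW (D u₁) (D u₂) (D u₃) (D u₄)
      simp only [hmetric]
      rw [hD (curvatureOf _ _ _ _ _ _), h]
      exact sub_eq_zero.1 hw
  exact key
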